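/- Let $N,m,d\ge 2$ be integers and $\omega=e^{2\pi \mathrm{i}/d}$ (with $\omega^r=e^{2\pi \mathrm{i}r/d}$ for real $r$). Each of $N$ parties $i=1,\dots,N$ has a finite-dimensional Hilbert space $\mathcal H_i$ and $m$ unitary $d$-outcome observables $A_{i,1},\dots,A_{i,m}$ on it, i.e. $A_{i,x}$ is unitary with $A_{i,x}^d=\mathbb 1$; put $A_{i,x+m}=\omega A_{i,x}$. The parties share a state (density operator) $\rho$ on $\mathcal H_1\otimes\dots\otimes\mathcal H_N$. The value of the ASTA Bell expression is $$\mathcal B_{m,d,N}=\sum_{\alpha_1,\dots,\alpha_{N-1}=1}^m\ \sum_{k=1}^{d-1}\operatorname{Tr}\Big[\rho\,\big(a_kA_{1,\alpha_1}^k+a_k^*A_{1,\alpha_1+1}^k\big)\otimes\bigotimes_{i=2}^N A_{i,\alpha_{i-1}+\alpha_i-1}^{(-1)^{i-1}k}\Big],\qquad a_k=\frac{\omega^{(2k-d)/(4m)}}{2\cos(\pi/2m)},\quad \alpha_N=1 .$$ Let $F=\frac1{\sqrt d}\sum_{i,j=0}^{d-1}\omega^{ij}|i\rangle\langle j|$,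 $\Omega=\mathrm{diag}(1,\omega,\dots,\omega^{d-1})$ and $D(r)=\sum_{j=0}^{d-1}\omega^{jr}|j\rangle\langle j|$. The generalised CGLMP observables on $\mathbb C^d$ are, for $x=1,\dots,m$, $$\mathcal O_{1,x}=U_xF\Omega F^\dagger U_x^\dagger,\qquad \mathcal O_{2,x}=V_xF^\dagger\Omega FV_x^\dagger,$$ $$\mathcal O_{i,x}=W_xF\Omega F^\dagger W_x^\dagger\ \ (i\ge3\text{ odd}),\qquad \mathcal O_{i,x}=W_x^\dagger F^\dagger\Omega FW_x\ \ (i\ge 4\text{ even}),$$ where $U_x=D\big(-\tfrac{x}{m}+\tfrac1{2m}\big)$, $V_x=D\big(\tfrac xm\big)$ and $W_x=D\big(-\tfrac{x-1}m\big)$. Let $|\mathrm{GHZ}_{N,d}\rangle=\frac1{\sqrt d}\sum_{j=0}^{d-1}|j\rangle^{\otimes N}$. **Theorem 3.1.** The maximal value of $\mathcal B_{m,d,N}$ over all such states and observables is $m^{N-1}(d-1)$. Suppose that $\rho$ and $A_{i,x}$ reach this value, and that the reduced state of $\rho$ on each $\mathcal H_i$ has full rank. Then: 1. For every $i$, $\mathcal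 H_i=\mathbb C^d\otimes\mathcal H_i''$ for some finite-dimensional Hilbert space $\mathcal H_i''$. 2. There are unitaries $U_i:\mathcal H_i\to\mathcal H_i$ and a state $\rho^{\mathrm{aux}}$ on $\mathcal H_1''\otimes\dots\otimes\mathcal H_N''$ such that $$(U_1\otimes\dots\otimes U_N)\,\rho\,(U_1\otimes\dots\otimes U_N)^\dagger=|\mathrm{GHZ}_{N,d}\rangle\langle\mathrm{GHZ}_{N,d}|\otimes\rho^{\mathrm{aux}},$$ $$U_i\,A_{i,x}\,U_i^\dagger=\mathcal O_{i,x}\otimes\mathbb 1_{\mathcal H_i''}\qquad\text{for all } i=1,\dots,N,\ x=1,\dots,m .$$ -/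

import Mathlib

open scoped ComplexOrder Kronecker

noncomputable section

namespace ASTA

/-- `ω ^ r` for a real exponent `r`, where `ω = exp (2πi / d)`. -/
def omegaPow (d : ℕ) (r : ℝ) : ℂ :=
  Complex.exp (2 * Real.pi * Complex.I * r / d)

/-- The coefficient `a_k = ω ^ ((2k - d) / (4m)) / (2 cos (π / (2m)))`. -/
def aCoeff (m d k : ℕ) : ℂ :=
  omegaPow d ((2 * k - d) / (4 * m)) / ((2 * Real.cos (Real.pi / (2 * m)) : ℝ) : ℂ)

section Operators

universe u

variable {N : ℕ} {n : Fin N → Type u}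

/-- The operator `M_1 ⊗ ⋯ ⊗ M_N` on `⨂ i, ℂ^(n i)`, in the product basis indexed by `Π i, n i`. -/
def tensor (M : ∀ i, Matrix (n i) (n i) ℂ) : Matrix (∀ i, n i) (∀ i, n i) ℂ :=
  Matrix.of fun x y => ∏ i, M i (x i) (y i)

/-- The reduced state of party `i`: the partial trace of `ρ` over all the other parties. -/
def reducedState [∀ i, Fintype (n i)] [∀ i, DecidableEq (n i)]
    (ρ : Matrix (∀ i, n i) (∀ i, n i) ℂ) (i : Fin N) : Matrix (n i) (n i) ℂ :=
  Matrix.of fun a b => ∑ x : ∀ j, n j, if x i = a then ρ x (Function.update x i b) else 0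

/-- Density operators: positive semidefinite of trace one. -/
def IsState {κ : Type u} [Fintype κ] (ρ : Matrix κ κ ℂ) : Prop :=
  ρ.PosSemidef ∧ ρ.trace = 1

/-- Unitary `d`-outcome observables: unitary matrices whose eigenvalues are `d`-th roots of
unity. -/
def IsObservable (d : ℕ) {κ : Type u} [Fintype κ] [DecidableEq κ] (A : Matrix κ κ ℂ) : Prop :=
  A ∈ Matrix.unitaryGroup κ ℂ ∧ A ^ d = 1

/-- The observables `A_0, …, A_{m-1}` of one party, extended to all settings `q` by
`A_{q + m} = ω A_q`. (Settings are counted from `0`: setting `q` here is setting `q + 1` in the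
numbering `1, …, m`.) -/
def extObs {m : ℕ} (d : ℕ) {κ : Type u} (A : Fin m → Matrix κ κ ℂ) (q : ℕ) : Matrix κ κ ℂ :=
  if h : 0 < m then omegaPow d ((q / m : ℕ) : ℝ) • A ⟨q % m, Nat.mod_lt q h⟩ else 0

/-- The summation indices `α_1, …, α_{N-1}`, counted from `0` both in their position and in their
value, and continued by `0` (this is the convention `α_N = 1` of the numbering `1, …, m`). -/
def settingIndex {m : ℕ} (α : Fin (N - 1) → Fin m) (j : ℕ) : ℕ :=
  if h : j < N - 1 then (α ⟨j, h⟩ : ℕ) else 0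

/-- The tensor factor of party `i` in the term `(α, k)` of the Bell operator. Parties are counted
from `0`. The first party has `a_k A_{1,α_1}^k + a_k^* A_{1,α_1+1}^k`; a later party has
`A_{i, α_{i-1} + α_i - 1}` (numbering from `1`) to the power `k` or `-k` alternately, where
`A^{-k} = (A†)^k` as `A` is unitary. -/
def bellFactor [∀ i, Fintype (n i)] [∀ i, DecidableEq (n i)] {m : ℕ} (d : ℕ)
    (A : ∀ i, Fin m → Matrix (n i) (n i) ℂ) (α : Fin (N - 1) → Fin m) (k : ℕ) (i : Fin N) :
    Matrix (n i) (n i) ℂ :=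
  if (i : ℕ) = 0 then
    aCoeff m d k • extObs d (A i) (settingIndex α 0) ^ k
      + star (aCoeff m d k) • extObs d (A i) (settingIndex α 0 + 1) ^ k
  else if Even (i : ℕ) then
    extObs d (A i) (settingIndex α (i - 1) + settingIndex α i) ^ k
  else
    (extObs d (A i) (settingIndex α (i - 1) + settingIndex α i)).conjTranspose ^ k

/-- The Bell operator. -/
def bellOperator [∀ i, Fintype (n i)] [∀ i, DecidableEq (n i)] {m : ℕ} (d : ℕ)
    (A : ∀ i, Fin m → Matrix (n i) (n i) ℂ) : Matrix (∀ i, n i) (∀ i, n i) ℂ :=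
  ∑ α : Fin (N - 1) → Fin m, ∑ k ∈ Finset.Icc 1 (d - 1), tensor (bellFactor d A α k)

/-- The value of the Bell expression. (The trace is real, since the terms `k` and `d - k` are
adjoint to each other.) -/
def bellValue [∀ i, Fintype (n i)] [∀ i, DecidableEq (n i)] {m : ℕ} (d : ℕ)
    (A : ∀ i, Fin m → Matrix (n i) (n i) ℂ) (ρ : Matrix (∀ i, n i) (∀ i, n i) ℂ) : ℝ :=
  (bellOperator d A * ρ).trace.re

end Operators

/-- All values of the Bell expression attained by a state of `N` finite-dimensional quantum systems
and `m` unitary `d`-outcome observables per party. -/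
def quantumValues (N m d : ℕ) : Set ℝ :=
  {v | ∃ (D : Fin N → ℕ) (A : ∀ i, Fin m → Matrix (Fin (D i)) (Fin (D i)) ℂ)
      (ρ : Matrix (∀ i, Fin (D i)) (∀ i, Fin (D i)) ℂ),
      IsState ρ ∧ (∀ i x, IsObservable d (A i x)) ∧ bellValue d A ρ = v}

/-- The vector `|GHZ_{N,d}⟩ = d^{-1/2} ∑ j, |j⟩^{⊗ N}`. -/
def ghz (N d : ℕ) (x : Fin N → Fin d) : ℂ :=
  ((1 / Real.sqrt d : ℝ) : ℂ) * ∑ j : Fin d, ∏ i, if x i = j then 1 else 0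

/-- The projector `|GHZ_{N,d}⟩⟨GHZ_{N,d}|`. -/
def ghzState (N d : ℕ) : Matrix (Fin N → Fin d) (Fin N → Fin d) ℂ :=
  Matrix.vecMulVec (ghz N d) (star (ghz N d))

/-- The Fourier matrix `F_d = d^{-1/2} ∑ i j, ω^{ij} |i⟩⟨j|`. -/
def fourier (d : ℕ) : Matrix (Fin d) (Fin d) ℂ :=
  Matrix.of fun i j => ((1 / Real.sqrt d : ℝ) : ℂ) * omegaPow d ((i : ℝ) * (j : ℝ))

/-- The diagonal unitary `∑ j, ω^{j r} |j⟩⟨j|`. -/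
def phase (d : ℕ) (r : ℝ) : Matrix (Fin d) (Fin d) ℂ :=
  Matrix.diagonal fun j => omegaPow d ((j : ℝ) * r)

/-- `Ω_d = diag (1, ω, …, ω^{d-1})`. -/
def clock (d : ℕ) : Matrix (Fin d) (Fin d) ℂ :=
  phase d 1

/-- The generalised CGLMP observables `O_{i,x}`. Parties and settings are counted from `0`, so with
`X = x + 1` in the numbering `1, …, m` the three phases are `γ = X/m - 1/(2m)`, `ζ = X/m` and
`θ = (X - 1)/m`, and an even `i` is a party with an odd number in the numbering `1, …, N`. -/
def idealObs (m d : ℕ) (i x : ℕ) : Matrix (Fin d) (Fin d) ℂ :=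
  let γ : ℝ := (x + 1) / m - 1 / (2 * m)
  let ζ : ℝ := (x + 1) / m
  let θ : ℝ := x / m
  let F := fourier d
  let U := phase d (-γ)
  let V := phase d ζ
  let W := phase d (-θ)
  if i = 0 then U * F * clock d * F.conjTranspose * U.conjTranspose
  else if i = 1 then V * F.conjTranspose * clock d * F * V.conjTranspose
  else if Even i then W * F * clock d * F.conjTranspose * W.conjTranspose
  else W.conjTranspose * F.conjTranspose * clock d * F * W

end ASTA

end

/-!
The Bell value splits, over the settings of the parties and the powers `k`, into expectations of
operators `(a_k A_x ^ k + a_k^* A_{x+1} ^ k) ⊗ (unitary)`, and by the Cauchy–Schwarz inequality each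
of them is at most the norm of its first factor in the state `ρ`. Up to phases, such a norm is that
of the sum of two consecutive terms of an antiperiodic sequence of unit vectors, divided by
`2 cos (π / (2 m))`. The angles between consecutive terms add up to at least `π`, so by concavity
of the cosine the `m` norms sum to at most `m`.

Equality makes every one of those operators stabilise `ρ` and forces a three-term recursion on
the powers of the observables of the first party. Comparing the solutions for different powers shows
that the observables are all twists of a single unitary which cyclically shifts `d` orthogonal
projections. The stabilising relations carry this structure to the other parties. In a basis
adapted to the projections the observables become the ideal ones, and the vectors fixed by the
stabilising operators have the form `GHZ ⊗ v`.
-/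

namespace ASTA

/-! ### Powers of `ω` -/

section OmegaPow

variable {d : ℕ}

lemma omegaPow_zero (d : ℕ) : omegaPow d 0 = 1 := by simp [omegaPow]

lemma omegaPow_add (d : ℕ) (r s : ℝ) : omegaPow d (r + s) = omegaPow d r * omegaPow d s := by
  rw [omegaPow, omegaPow, omegaPow, ← Complex.exp_add]
  congr 1
  push_cast
  ring

lemma star_omegaPow (d : ℕ) (r : ℝ) : star (omegaPow d r) = omegaPow d (-r) := by
  simp only [omegaPow, Complex.star_def, ← Complex.exp_conj]
  congr 1
  simp only [map_div₀, map_mul, Complex.conj_ofReal, Complex.conj_I, map_natCast,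
    Complex.conj_ofNat]
  push_cast
  ring

lemma omegaPow_mul_neg (d : ℕ) (r : ℝ) : omegaPow d r * omegaPow d (-r) = 1 := by
  rw [← omegaPow_add, add_neg_cancel, omegaPow_zero]

lemma omegaPow_neg_mul (d : ℕ) (r : ℝ) : omegaPow d (-r) * omegaPow d r = 1 := by
  rw [← omegaPow_add, neg_add_cancel, omegaPow_zero]

lemma omegaPow_ne_zero (d : ℕ) (r : ℝ) : omegaPow d r ≠ 0 := Complex.exp_ne_zero _

lemma omegaPow_pow (d : ℕ) (r : ℝ) (k : ℕ) : omegaPow d r ^ k = omegaPow d (k * r) := by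
  rw [omegaPow, omegaPow, ← Complex.exp_nat_mul]
  congr 1
  push_cast
  ring

lemma norm_omegaPow (d : ℕ) (r : ℝ) : ‖omegaPow d r‖ = 1 := by
  simp [omegaPow, Complex.norm_exp]

lemma omegaPow_dim_mul (hd : d ≠ 0) (r : ℝ) :
    omegaPow d (d * r) = Complex.exp ((2 * Real.pi * r : ℝ) * Complex.I) := by
  rw [omegaPow]
  congr 1
  have : (d : ℂ) ≠ 0 := by exact_mod_cast hd
  push_cast
  field_simp

lemma omegaPow_dim (hd : d ≠ 0) : omegaPow d d = 1 := by
  simpa [Complex.exp_two_pi_mul_I] using omegaPow_dim_mul hd 1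

lemma omegaPow_dim_mul_ne_one (hd : d ≠ 0) {r : ℝ} (h0 : 0 < r) (h1 : r < 1) :
    omegaPow d (d * r) ≠ 1 := by
  rw [omegaPow_dim_mul hd]
  intro h
  obtain ⟨n, hn⟩ := Complex.exp_eq_one_iff.1 h
  have hrn : (r : ℂ) = n := mul_right_cancel₀ Complex.two_pi_I_ne_zero <| by
    rw [← hn]
    push_cast
    ring
  have hrn' : r = n := by exact_mod_cast hrn
  have hn0 : 0 < n := by exact_mod_cast hrn' ▸ h0
  have hn1 : n < 1 := by exact_mod_cast hrn' ▸ h1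
  omega

lemma omegaPow_half_dim_mul_add_neg (hd : d ≠ 0) (s : ℝ) :
    omegaPow d (d / 2 * s) + omegaPow d (-(d / 2 * s)) =
      ((2 * Real.cos (Real.pi * s) : ℝ) : ℂ) := by
  rw [show d / 2 * s = d * (s / 2) by ring, ← star_omegaPow, omegaPow_dim_mul hd,
    Complex.star_def, Complex.add_conj, Complex.exp_ofReal_mul_I_re]
  ring_nf

lemma star_omegaPow_dim_mul_ne_self (hd : d ≠ 0) {r : ℝ} (h0 : 0 < r) (h1 : 2 * r < 1) :
    star (omegaPow d (d * r)) ≠ omegaPow d (d * r) := by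
  intro h
  refine omegaPow_dim_mul_ne_one hd (by positivity : 0 < 2 * r) h1 ?_
  rw [show d * (2 * r) = d * r + d * r by ring, omegaPow_add]
  nth_rw 1 [← h]
  rw [star_omegaPow, omegaPow_neg_mul]

end OmegaPow

/-! ### Antiperiodic sequences of unit vectors -/

section Antiperiodic

open Finset InnerProductGeometry Real

variable {ι : Type*} {s : Finset ι} {t : ι → ℝ} {τ : ℝ}

lemma mean_mem_Icc (hs : s.Nonempty) (ht : ∀ i ∈ s, t i ∈ Set.Icc 0 (π / 2)) :
    ∑ i ∈ s, (#s : ℝ)⁻¹ • t i ∈ Set.Icc 0 (π / 2) :=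
  (convex_Icc 0 (π / 2)).sum_mem (fun _ _ ↦ by positivity)
    (by simp [hs.card_pos.ne']) ht

lemma sum_cos_le_card_mul_cos_mean (hs : s.Nonempty) (ht : ∀ i ∈ s, t i ∈ Set.Icc 0 (π / 2)) :
    ∑ i ∈ s, cos (t i) ≤ #s * cos (∑ i ∈ s, (#s : ℝ)⁻¹ • t i) := by
  have hcard : (0 : ℝ) < #s := by exact_mod_cast hs.card_pos
  have hcos : ConcaveOn ℝ (Set.Icc 0 (π / 2)) cos := strictConcaveOn_cos_Icc.concaveOn.subset
    (Set.Icc_subset_Icc_left (by linarith [pi_pos])) (convex_Icc _ _)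
  have hJensen := hcos.le_map_sum (w := fun _ ↦ (#s : ℝ)⁻¹) (fun _ _ ↦ by positivity)
    (by simp [hcard.ne']) ht
  rwa [← smul_sum, smul_eq_mul, inv_mul_le_iff₀ hcard] at hJensen

lemma le_mean (hs : s.Nonempty) (hsum : #s * τ ≤ ∑ i ∈ s, t i) :
    τ ≤ ∑ i ∈ s, (#s : ℝ)⁻¹ • t i := by
  have hcard : (0 : ℝ) < #s := by exact_mod_cast hs.card_pos
  rwa [← smul_sum, smul_eq_mul, inv_mul_eq_div, le_div_iff₀' hcard]

lemma sum_cos_le (hs : s.Nonempty) (ht : ∀ i ∈ s, t i ∈ Set.Icc 0 (π / 2)) (hτ : 0 ≤ τ)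
    (hsum : #s * τ ≤ ∑ i ∈ s, t i) : ∑ i ∈ s, cos (t i) ≤ #s * cos τ :=
  (sum_cos_le_card_mul_cos_mean hs ht).trans <| by
    gcongr
    exact cos_le_cos_of_nonneg_of_le_pi hτ ((mean_mem_Icc hs ht).2.trans (by linarith [pi_pos]))
      (le_mean hs hsum)

lemma eq_of_card_mul_cos_le_sum_cos (hs : s.Nonempty) (ht : ∀ i ∈ s, t i ∈ Set.Icc 0 (π / 2))
    (hτ : 0 ≤ τ) (hsum : #s * τ ≤ ∑ i ∈ s, t i) (hmax : #s * cos τ ≤ ∑ i ∈ s, cos (t i)) :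
    ∀ i ∈ s, t i = τ := by
  have hcard : (0 : ℝ) < #s := by exact_mod_cast hs.card_pos
  set μ := ∑ i ∈ s, (#s : ℝ)⁻¹ • t i
  have hle : τ ≤ μ := le_mean hs hsum
  have hμ' : μ ∈ Set.Icc 0 (π / 2) := mean_mem_Icc hs ht
  have hμτ : μ = τ := by
    refine injOn_cos ⟨hμ'.1, by linarith [hμ'.2, pi_pos]⟩ ⟨hτ, by linarith [hμ'.2, pi_pos]⟩
      (le_antisymm ?_ ?_)
    · exact cos_le_cos_of_nonneg_of_le_pi hτ (by linarith [hμ'.2, pi_pos]) hle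
    · exact le_of_mul_le_mul_left (hmax.trans (sum_cos_le_card_mul_cos_mean hs ht)) hcard
  have hcos : StrictConcaveOn ℝ (Set.Icc 0 (π / 2)) cos := strictConcaveOn_cos_Icc.subset
    (Set.Icc_subset_Icc_left (by linarith [pi_pos])) (convex_Icc _ _)
  have hJensen : cos μ = ∑ i ∈ s, (#s : ℝ)⁻¹ • cos (t i) := by
    rw [← smul_sum, smul_eq_mul, eq_inv_mul_iff_mul_eq₀ hcard.ne']
    exact le_antisymm (hμτ ▸ hmax) (sum_cos_le_card_mul_cos_mean hs ht)
  intro i hi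
  rw [← hμτ]
  exact (hcos.map_sum_eq_iff' (fun _ _ ↦ by positivity) (by simp [hcard.ne']) ht).1 hJensen i hi
    (inv_ne_zero hcard.ne')

variable {V : Type*} [NormedAddCommGroup V] [InnerProductSpace ℝ V]

lemma real_inner_eq_cos_angle {x y : V} (hx : ‖x‖ = 1) (hy : ‖y‖ = 1) :
    inner ℝ x y = cos (angle x y) := by
  rw [cos_angle, hx, hy, mul_one, div_one]

lemma norm_add_eq_two_mul_cos {x y : V} (hx : ‖x‖ = 1) (hy : ‖y‖ = 1) :
    ‖x + y‖ = 2 * cos (angle x y / 2) := by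
  have hcos : 0 ≤ cos (angle x y / 2) := cos_nonneg_of_mem_Icc
    ⟨by linarith [angle_nonneg x y, pi_pos], by linarith [angle_le_pi x y]⟩
  have hdouble := cos_two_mul (angle x y / 2)
  rw [mul_div_cancel₀ _ two_ne_zero] at hdouble
  rw [← sq_eq_sq₀ (norm_nonneg _) (by positivity), norm_add_sq_real, hx, hy,
    real_inner_eq_cos_angle hx hy]
  linarith

lemma angle_le_sum_angle {u : ℕ → V} (hu : ∀ x, ‖u x‖ = 1) {a b : ℕ} (hab : a ≤ b) :
    angle (u a) (u b) ≤ ∑ x ∈ Ico a b, angle (u x) (u (x + 1)) := by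
  induction b, hab using Nat.le_induction with
  | base => simp [angle_self (norm_ne_zero_iff.1 (hu a ▸ one_ne_zero))]
  | succ b hab ih =>
    rw [sum_Ico_succ_top hab]
    linarith [angle_le_angle_add_angle (u a) (u b) (u (b + 1))]

variable {u : ℕ → V} {m : ℕ}

lemma pi_le_sum_angle (hu : ∀ x, ‖u x‖ = 1) (hanti : u m = -u 0) :
    π ≤ ∑ x ∈ range m, angle (u x) (u (x + 1)) := by
  have hpath := angle_le_sum_angle hu (Nat.zero_le m)
  rwa [hanti, angle_self_neg_of_nonzero (norm_ne_zero_iff.1 (hu 0 ▸ one_ne_zero)),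
    ← range_eq_Ico] at hpath

lemma half_angle_mem_Icc (x y : V) : angle x y / 2 ∈ Set.Icc 0 (π / 2) :=
  ⟨by linarith [angle_nonneg x y], by linarith [angle_le_pi x y]⟩

lemma card_mul_le_sum_half_angle (hm : m ≠ 0) (hu : ∀ x, ‖u x‖ = 1) (hanti : u m = -u 0) :
    #(range m) * (π / (2 * m)) ≤ ∑ x ∈ range m, angle (u x) (u (x + 1)) / 2 := by
  have : (0 : ℝ) < m := by positivity
  rw [card_range, ← sum_div]
  field_simp
  exact pi_le_sum_angle hu hanti

lemma sum_norm_add_succ_le (hm : m ≠ 0) (hu : ∀ x, ‖u x‖ = 1) (hanti : u m = -u 0) :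
    ∑ x ∈ range m, ‖u x + u (x + 1)‖ ≤ m * (2 * cos (π / (2 * m))) := by
  have hcos := sum_cos_le (nonempty_range_iff.2 hm) (fun _ _ ↦ half_angle_mem_Icc _ _)
    (by positivity) (card_mul_le_sum_half_angle hm hu hanti)
  rw [card_range] at hcos
  simp only [norm_add_eq_two_mul_cos (hu _) (hu _), ← mul_sum]
  linarith

lemma angle_eq_of_le_sum (hm : m ≠ 0) (hu : ∀ x, ‖u x‖ = 1) (hanti : u m = -u 0)
    (hmax : m * (2 * cos (π / (2 * m))) ≤ ∑ x ∈ range m, ‖u x + u (x + 1)‖) :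
    ∀ x < m, angle (u x) (u (x + 1)) = π / m := by
  simp only [norm_add_eq_two_mul_cos (hu _) (hu _), ← mul_sum] at hmax
  intro x hx
  have hhalf := eq_of_card_mul_cos_le_sum_cos (nonempty_range_iff.2 hm)
    (fun _ _ ↦ half_angle_mem_Icc _ _) (by positivity) (card_mul_le_sum_half_angle hm hu hanti)
    (by rw [card_range]; linarith) x (mem_range.2 hx)
  rw [div_eq_iff two_ne_zero] at hhalf
  rw [hhalf]
  field_simp

lemma norm_add_succ_eq_of_le_sum (hu : ∀ x, ‖u x‖ = 1) (hanti : u m = -u 0)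
    (hmax : m * (2 * cos (π / (2 * m))) ≤ ∑ x ∈ range m, ‖u x + u (x + 1)‖) {x : ℕ} (hx : x < m) :
    ‖u x + u (x + 1)‖ = 2 * cos (π / (2 * m)) := by
  rw [norm_add_eq_two_mul_cos (hu _) (hu _),
    angle_eq_of_le_sum (by omega) hu hanti hmax x hx, div_div, mul_comm (m : ℝ)]

lemma angle_add_two_eq (hu : ∀ x, ‖u x‖ = 1) (hanti : u m = -u 0)
    (hangle : ∀ x < m, angle (u x) (u (x + 1)) = π / m) {x : ℕ} (hx : x + 2 ≤ m) :
    angle (u x) (u (x + 2)) = 2 * (π / m) := by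
  have hpath {a b : ℕ} (hab : a ≤ b) (hb : b ≤ m) :
      angle (u a) (u b) ≤ (b - a) * (π / m) := by
    refine (angle_le_sum_angle hu hab).trans_eq ?_
    rw [sum_congr rfl fun y hy ↦ hangle y (by rw [mem_Ico] at hy; omega), sum_const, Nat.card_Ico,
      nsmul_eq_mul, Nat.cast_sub hab]
  have hfull : π = m * (π / m) := by
    have : (m : ℝ) ≠ 0 := by norm_cast; omega
    field_simp
  have hanti' : angle (u 0) (u m) = π := by
    rw [hanti, angle_self_neg_of_nonzero (norm_ne_zero_iff.1 (hu 0 ▸ one_ne_zero))]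
  have h0 := hpath (Nat.zero_le x) (by omega)
  have h1 := hpath (Nat.le_add_right x 2) hx
  have h2 := hpath hx le_rfl
  have h3 := angle_le_angle_add_angle (u 0) (u x) (u m)
  have h4 := angle_le_angle_add_angle (u x) (u (x + 2)) (u m)
  push_cast at h0 h1 h2
  linarith

lemma eq_two_mul_cos_smul_sub {x y z : V} {θ : ℝ} (hx : ‖x‖ = 1) (hy : ‖y‖ = 1) (hz : ‖z‖ = 1)
    (hxy : angle x y = θ) (hyz : angle y z = θ) (hxz : angle x z = 2 * θ) :
    z = (2 * cos θ) • y - x := by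
  have hxy' := real_inner_eq_cos_angle hx hy
  have hyz' := real_inner_eq_cos_angle hy hz
  have hxz' := real_inner_eq_cos_angle hx hz
  rw [hxz, cos_two_mul] at hxz'
  rw [← sub_eq_zero, ← norm_eq_zero, ← sq_eq_zero_iff, norm_sub_sq_real, norm_sub_sq_real,
    norm_smul, mul_pow, hx, hy, hz, norm_eq_abs, sq_abs, inner_sub_right, inner_smul_left,
    inner_smul_right, real_inner_comm, real_inner_comm _ z, hyz', hxz', real_inner_comm, hxy', hxy,
    hyz]
  simp
  ring

lemma add_two_eq_of_le_sum (hu : ∀ x, ‖u x‖ = 1) (hanti : u m = -u 0)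
    (hmax : m * (2 * cos (π / (2 * m))) ≤ ∑ x ∈ range m, ‖u x + u (x + 1)‖) {x : ℕ}
    (hx : x + 2 ≤ m) : u (x + 2) = (2 * cos (π / m)) • u (x + 1) - u x := by
  have hangle := angle_eq_of_le_sum (by omega) hu hanti hmax
  exact eq_two_mul_cos_smul_sub (hu _) (hu _) (hu _) (hangle x (by omega))
    (hangle (x + 1) (by omega)) (angle_add_two_eq hu hanti hangle hx)

end Antiperiodic

/-! ### Tensor products and local operators -/

open Matrix Function

section TensorAlgebra

universe u

variable {N : ℕ} {n : Fin N → Type u}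

lemma tensor_apply (M : ∀ i, Matrix (n i) (n i) ℂ) (x y : ∀ i, n i) :
    tensor M x y = ∏ i, M i (x i) (y i) := rfl

lemma conjTranspose_tensor (M : ∀ i, Matrix (n i) (n i) ℂ) : (tensor M)ᴴ = tensor (star M) := by
  ext x y
  simp [tensor_apply, conjTranspose_apply, star_apply]

section Mul

variable [∀ i, Fintype (n i)]

lemma tensor_mul (M M' : ∀ i, Matrix (n i) (n i) ℂ) : tensor M * tensor M' = tensor (M * M') := by
  ext x y
  simp only [tensor_apply, mul_apply, Pi.mul_apply, ← Finset.prod_mul_distrib,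
    Finset.prod_univ_sum, Fintype.piFinset_univ]

end Mul

variable [∀ i, DecidableEq (n i)]

lemma tensor_one : tensor (1 : ∀ i, Matrix (n i) (n i) ℂ) = 1 := by
  ext x y
  simp only [tensor_apply, Pi.one_apply, one_apply, Finset.prod_ite_zero, Finset.prod_const_one,
    Finset.mem_univ, true_imp_iff, funext_iff]

lemma tensor_update_one_apply (i : Fin N) (X : Matrix (n i) (n i) ℂ) (x y : ∀ i, n i) :
    tensor (update 1 i X) x y = if y = update x i (y i) then X (x i) (y i) else 0 := by
  have hrest : ∏ j ∈ Finset.univ.erase i, update (1 : ∀ i, Matrix (n i) (n i) ℂ) i X j (x j) (y j)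
      = if y = update x i (y i) then 1 else 0 := by
    rw [Finset.prod_congr rfl (g := fun j ↦ if x j = y j then (1 : ℂ) else 0) fun j hj ↦ by
      rw [update_of_ne (Finset.ne_of_mem_erase hj), Pi.one_apply, one_apply]]
    simp [Finset.prod_ite_zero, eq_update_iff, eq_comm]
  rw [tensor_apply, ← Finset.mul_prod_erase _ _ (Finset.mem_univ i), update_self, hrest,
    mul_ite, mul_one, mul_zero]

lemma tensor_update_one_one (i : Fin N) :
    tensor (update (1 : ∀ i, Matrix (n i) (n i) ℂ) i 1) = 1 :=
  (congrArg tensor (update_eq_self i _)).trans tensor_one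

variable [∀ i, Fintype (n i)]

lemma tensor_pow (M : ∀ i, Matrix (n i) (n i) ℂ) (k : ℕ) : tensor M ^ k = tensor (M ^ k) := by
  induction k with
  | zero => rw [pow_zero, pow_zero, tensor_one]
  | succ k ih => rw [pow_succ, pow_succ, ih, tensor_mul]

variable (n) in
/-- The embedding `X ↦ 1 ⊗ ⋯ ⊗ X ⊗ ⋯ ⊗ 1` of the operators of party `i` into the operators on the
whole tensor product, as a homomorphism of `*`-algebras. -/
def locHom (i : Fin N) : Matrix (n i) (n i) ℂ →⋆ₐ[ℂ] Matrix (∀ i, n i) (∀ i, n i) ℂ where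
  toFun X := tensor (update 1 i X)
  map_one' := tensor_update_one_one i
  map_mul' X Y := by rw [tensor_mul, ← update_mul, one_mul]
  map_zero' := by ext; simp [tensor_update_one_apply]
  map_add' X Y := by
    ext
    simp only [Matrix.add_apply, tensor_update_one_apply]
    split_ifs <;> simp
  commutes' c := by
    rw [Algebra.algebraMap_eq_smul_one, Algebra.algebraMap_eq_smul_one, ← tensor_update_one_one i]
    ext
    simp only [Matrix.smul_apply, tensor_update_one_apply]
    split_ifs <;> simp
  map_star' X := by
    simp only [star_eq_conjTranspose, conjTranspose_tensor]
    congr 1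
    ext1 j
    simp only [Pi.star_apply, star_eq_conjTranspose, apply_update (fun _ ↦ conjTranspose),
      Pi.one_apply, conjTranspose_one]
    rfl

lemma locHom_apply (i : Fin N) (X : Matrix (n i) (n i) ℂ) :
    locHom n i X = tensor (update 1 i X) := rfl

lemma locHom_mul_locHom {i j : Fin N} (hij : i ≠ j) (X : Matrix (n i) (n i) ℂ)
    (Y : Matrix (n j) (n j) ℂ) :
    locHom n i X * locHom n j Y = tensor (update (update 1 i X) j Y) := by
  rw [locHom_apply, locHom_apply, tensor_mul]
  congr 1
  ext1 k
  by_cases hk : k = j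
  · subst hk; simp [hij.symm]
  · simp [hk]

lemma locHom_commute {i j : Fin N} (hij : i ≠ j) (X : Matrix (n i) (n i) ℂ)
    (Y : Matrix (n j) (n j) ℂ) : Commute (locHom n i X) (locHom n j Y) := by
  rw [commute_iff_eq, locHom_mul_locHom hij, locHom_mul_locHom hij.symm, update_comm hij]

lemma locHom_mul_apply (ρ : Matrix (∀ i, n i) (∀ i, n i) ℂ) (i : Fin N)
    (X : Matrix (n i) (n i) ℂ) (x y : ∀ i, n i) :
    (locHom n i X * ρ) x y = ∑ c, X (x i) c * ρ (update x i c) y := by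
  simp only [mul_apply, locHom_apply, tensor_update_one_apply, ite_mul, zero_mul]
  rw [← Finset.sum_filter]
  refine Finset.sum_nbij' (fun z ↦ z i) (fun c ↦ update x i c) (by simp) (by simp)
    (fun z hz ↦ (Finset.mem_filter.1 hz).2.symm) (by simp) fun z hz ↦ ?_
  rw [← (Finset.mem_filter.1 hz).2]

lemma reducedState_locHom_mul (ρ : Matrix (∀ i, n i) (∀ i, n i) ℂ) (i : Fin N)
    (X : Matrix (n i) (n i) ℂ) :
    reducedState (locHom n i X * ρ) i = X * reducedState ρ i := by
  ext a b
  simp only [reducedState, of_apply, locHom_mul_apply, mul_apply (M := X), ← Finset.sum_filter,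
    Finset.mul_sum (s := Finset.filter _ _)]
  rw [Finset.sum_comm]
  refine Finset.sum_congr rfl fun c _ ↦ ?_
  refine Finset.sum_nbij' (fun x ↦ update x i c) (fun x ↦ update x i a) (by simp) (by simp)
    ?_ ?_ ?_
  all_goals
    intro x hx
    simp [← (Finset.mem_filter.1 hx).2]

lemma eq_of_locHom_mul_eq {ρ : Matrix (∀ i, n i) (∀ i, n i) ℂ} {i : Fin N}
    (hρ : (reducedState ρ i).rank = Fintype.card (n i)) {X Y : Matrix (n i) (n i) ℂ}
    (h : locHom n i X * ρ = locHom n i Y * ρ) : X = Y := by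
  have hred : X * reducedState ρ i = Y * reducedState ρ i := by
    rw [← reducedState_locHom_mul, ← reducedState_locHom_mul, h]
  have hunit : IsUnit (reducedState ρ i) := by
    rw [← linearIndependent_rows_iff_isUnit, linearIndependent_iff_card_eq_finrank_span,
      Set.finrank, ← rank_eq_finrank_span_row, hρ]
  exact hunit.mul_right_cancel hred

end TensorAlgebra

/-! ### The norm of an operator in a state -/

section StateNorm

variable {κ : Type*} [Fintype κ] {ρ : Matrix κ κ ℂ}

/-- The seminorm `‖X‖_ρ = √ tr (X† X ρ)` of an operator in the state `ρ`. -/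
noncomputable def stateNorm (ρ X : Matrix κ κ ℂ) : ℝ := √(Xᴴ * X * ρ).trace.re

lemma norm_eq_stateNorm {E : Type*} [NormedAddCommGroup E] [InnerProductSpace ℂ E]
    {Φ : Matrix κ κ ℂ →ₗ[ℂ] E} (hΦ : ∀ X Y, inner ℂ (Φ X) (Φ Y) = (Xᴴ * Y * ρ).trace)
    (X : Matrix κ κ ℂ) : ‖Φ X‖ = stateNorm ρ X := by
  rw [norm_eq_sqrt_re_inner (𝕜 := ℂ), hΦ, stateNorm, RCLike.re_eq_complex_re]

lemma stateNorm_smul (ρ X : Matrix κ κ ℂ) (c : ℂ) :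
    stateNorm ρ (c • X) = ‖c‖ * stateNorm ρ X := by
  rw [stateNorm, stateNorm, conjTranspose_smul, Matrix.smul_mul, Matrix.mul_smul, smul_smul,
    Matrix.smul_mul, trace_smul, smul_eq_mul, Complex.star_def, ← Complex.normSq_eq_conj_mul_self,
    Complex.re_ofReal_mul, Real.sqrt_mul (Complex.normSq_nonneg c), Complex.norm_def]

open scoped MatrixOrder in
lemma exists_eq_mul_conjTranspose (hρ : ρ.PosSemidef) : ∃ R : Matrix κ κ ℂ, ρ = R * Rᴴ := by
  classical
  obtain ⟨S, hS⟩ := CStarAlgebra.nonneg_iff_eq_star_mul_self.1 (nonneg_iff_posSemidef.2 hρ)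
  exact ⟨star S, by rw [hS, ← star_eq_conjTranspose, star_star]⟩

/-- The Gelfand–Naimark–Segal representation of the state: if `ρ = R * Rᴴ`, send `X` to the
entries of `X * R`. -/
lemma exists_gns (hρ : ρ.PosSemidef) :
    ∃ Φ : Matrix κ κ ℂ →ₗ[ℂ] EuclideanSpace ℂ (κ × κ),
      (∀ X Y, inner ℂ (Φ X) (Φ Y) = (Xᴴ * Y * ρ).trace) ∧ ∀ X, Φ X = 0 → X * ρ = 0 := by
  obtain ⟨R, rfl⟩ := exists_eq_mul_conjTranspose hρ
  refine ⟨⟨⟨fun X ↦ WithLp.toLp 2 fun p ↦ (X * R) p.1 p.2, ?_⟩, ?_⟩, fun X Y ↦ ?_, fun X hX ↦ ?_⟩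
  · intro X Y
    ext p
    simp [Matrix.add_mul]
  · intro c X
    ext p
    simp
  · have : (Xᴴ * Y * (R * Rᴴ)).trace = ((X * R)ᴴ * (Y * R)).trace := by
      rw [conjTranspose_mul, ← Matrix.mul_assoc, trace_mul_comm]
      simp only [Matrix.mul_assoc]
    rw [this]
    simp only [PiLp.inner_apply, LinearMap.coe_mk, AddHom.coe_mk, Fintype.sum_prod_type,
      RCLike.inner_apply']
    exact Finset.sum_comm
  · rw [← Matrix.mul_assoc, show X * R = 0 from ?_, Matrix.zero_mul]
    ext a b
    simpa using congrArg (fun v ↦ v.ofLp (a, b)) hX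

lemma stateNorm_isometry_mul [DecidableEq κ] {V : Matrix κ κ ℂ} (hV : Vᴴ * V = 1)
    (ρ X : Matrix κ κ ℂ) :
    stateNorm ρ (V * X) = stateNorm ρ X := by
  rw [stateNorm, stateNorm, conjTranspose_mul, Matrix.mul_assoc Xᴴ, ← Matrix.mul_assoc Vᴴ, hV,
    Matrix.one_mul]

lemma stateNorm_eq_one [DecidableEq κ] (hρ : IsState ρ) {V : Matrix κ κ ℂ} (hV : Vᴴ * V = 1) :
    stateNorm ρ V = 1 := by
  rw [stateNorm, hV, Matrix.one_mul, hρ.2, Complex.one_re, Real.sqrt_one]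

lemma re_trace_mul_le_stateNorm (hρ : IsState ρ) (X : Matrix κ κ ℂ) :
    (X * ρ).trace.re ≤ stateNorm ρ X := by
  classical
  obtain ⟨Φ, hΦ, -⟩ := exists_gns hρ.1
  have hone : ‖Φ 1‖ = 1 := by
    rw [norm_eq_stateNorm hΦ, stateNorm_eq_one hρ (by simp)]
  simpa [hΦ, hone, norm_eq_stateNorm hΦ] using re_inner_le_norm (𝕜 := ℂ) (Φ 1) (Φ X)

/-- Equality in the Cauchy–Schwarz inequality `Re ⟨1, X⟩_ρ ≤ ‖1‖_ρ ‖X‖_ρ`. -/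
lemma mul_eq_self_of_one_le_re_trace_mul (hρ : IsState ρ) {X : Matrix κ κ ℂ}
    (hX : stateNorm ρ X = 1) (htr : 1 ≤ (X * ρ).trace.re) : X * ρ = ρ := by
  classical
  obtain ⟨Φ, hΦ, hΦ0⟩ := exists_gns hρ.1
  have hone : ‖Φ 1‖ = 1 := by
    rw [norm_eq_stateNorm hΦ, stateNorm_eq_one hρ (by simp)]
  have hsub : ‖Φ (1 - X)‖ ^ 2 ≤ 0 := by
    rw [map_sub, norm_sub_sq (𝕜 := ℂ), hone, norm_eq_stateNorm hΦ, hX, hΦ, conjTranspose_one,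
      Matrix.one_mul, RCLike.re_eq_complex_re]
    linarith
  have hzero := hΦ0 (1 - X) (norm_eq_zero.1 (pow_eq_zero_iff two_ne_zero |>.1
    (le_antisymm hsub (sq_nonneg _))))
  rwa [Matrix.sub_mul, Matrix.one_mul, sub_eq_zero, eq_comm] at hzero

variable [DecidableEq κ] {m : ℕ} {V : ℕ → Matrix κ κ ℂ}

lemma sum_stateNorm_add_succ_le (hρ : IsState ρ) (hm : m ≠ 0) (hV : ∀ x, (V x)ᴴ * V x = 1)
    (hanti : V m = -V 0) :
    ∑ x ∈ Finset.range m, stateNorm ρ (V x + V (x + 1)) ≤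
      m * (2 * Real.cos (Real.pi / (2 * m))) := by
  obtain ⟨Φ, hΦ, -⟩ := exists_gns hρ.1
  simp only [← norm_eq_stateNorm hΦ, map_add]
  exact sum_norm_add_succ_le hm
    (fun x ↦ by rw [norm_eq_stateNorm hΦ, stateNorm_eq_one hρ (hV x)]) (by rw [hanti, map_neg])

lemma stateNorm_add_succ_eq_of_max (hρ : IsState ρ) (hV : ∀ x, (V x)ᴴ * V x = 1)
    (hanti : V m = -V 0) (hmax : m * (2 * Real.cos (Real.pi / (2 * m))) ≤
      ∑ x ∈ Finset.range m, stateNorm ρ (V x + V (x + 1))) {x : ℕ} (hx : x < m) :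
    stateNorm ρ (V x + V (x + 1)) = 2 * Real.cos (Real.pi / (2 * m)) := by
  obtain ⟨Φ, hΦ, -⟩ := exists_gns hρ.1
  simp only [← norm_eq_stateNorm hΦ, map_add] at hmax ⊢
  exact norm_add_succ_eq_of_le_sum
    (fun x ↦ by rw [norm_eq_stateNorm hΦ, stateNorm_eq_one hρ (hV x)]) (by rw [hanti, map_neg])
    hmax hx

lemma add_two_mul_eq_of_max (hρ : IsState ρ) (hV : ∀ x, (V x)ᴴ * V x = 1)
    (hanti : V m = -V 0) (hmax : m * (2 * Real.cos (Real.pi / (2 * m))) ≤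
      ∑ x ∈ Finset.range m, stateNorm ρ (V x + V (x + 1))) {x : ℕ} (hx : x + 2 ≤ m) :
    V (x + 2) * ρ = (((2 * Real.cos (Real.pi / m) : ℝ) : ℂ) • V (x + 1) - V x) * ρ := by
  obtain ⟨Φ, hΦ, hΦ0⟩ := exists_gns hρ.1
  simp only [← norm_eq_stateNorm hΦ, map_add] at hmax
  have hrec := add_two_eq_of_le_sum
    (fun x ↦ by rw [norm_eq_stateNorm hΦ, stateNorm_eq_one hρ (hV x)])
    (show Φ (V m) = -Φ (V 0) by rw [hanti, map_neg]) hmax hx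
  rw [← sub_eq_zero, ← Matrix.sub_mul]
  refine hΦ0 _ ?_
  rw [map_sub, map_sub, map_smul, hrec, Complex.coe_smul, sub_self]

end StateNorm

/-! ### Cyclic shifts -/

section Twist

variable {R : Type*} [Ring R] [Algebra ℂ R]

/-- `ω ^ r` on the kernel of the projection `P` and `ω ^ (r - d r)` on its range. In the
correlations at the maximal value, changing the setting of a party multiplies its observable by
such a unitary. -/
noncomputable def twist (d : ℕ) (r : ℝ) (P : R) : R :=
  omegaPow d r • (1 - P) + omegaPow d (r - d * r) • P

lemma twist_eq (d : ℕ) (r : ℝ) (P : R) :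
    twist d r P = omegaPow d r • (1 + (omegaPow d (-(d * r)) - 1) • P) := by
  rw [twist, sub_eq_add_neg r, omegaPow_add]
  module

lemma twist_zero (d : ℕ) (P : R) : twist d 0 P = 1 := by
  simp [twist, omegaPow_zero]

lemma twist_mul_twist (d : ℕ) (r s : ℝ) {P : R} (hP : IsIdempotentElem P) :
    twist d r P * twist d s P = twist d (r + s) P := by
  have hexp : r + s - d * (r + s) = (r - d * r) + (s - d * s) := by ring
  rw [twist, twist, twist, hexp, omegaPow_add d r s, omegaPow_add d (r - d * r)]
  generalize omegaPow d (r - d * r) = a, omegaPow d (s - d * s) = b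
  simp only [mul_add, add_mul, mul_sub, sub_mul, smul_mul_assoc, mul_smul_comm, hP.eq, one_mul,
    mul_one]
  module

lemma twist_mul_neg (d : ℕ) (r : ℝ) {P : R} (hP : IsIdempotentElem P) :
    twist d r P * twist d (-r) P = 1 := by
  rw [twist_mul_twist d _ _ hP, add_neg_cancel, twist_zero]

lemma smul_twist_add_smul_twist (d : ℕ) (r s : ℝ) (P : R) :
    omegaPow d ((1 - d / 2) * s) • twist d (r - s) P +
        omegaPow d (-((1 - d / 2) * s)) • twist d (r + s) P =
      (omegaPow d (d / 2 * s) + omegaPow d (-(d / 2 * s))) • twist d r P := by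
  simp only [twist, smul_add, smul_smul, add_mul, ← omegaPow_add]
  rw [show (1 - d / 2) * s + (r - s) = -(d / 2 * s) + r by ring,
    show -((1 - d / 2) * s) + (r + s) = d / 2 * s + r by ring,
    show (1 - d / 2) * s + (r - s - d * (r - s)) = d / 2 * s + (r - d * r) by ring,
    show -((1 - d / 2) * s) + (r + s - d * (r + s)) = -(d / 2 * s) + (r - d * r) by ring]
  module

lemma star_twist [StarRing R] [StarModule ℂ R] (d : ℕ) (r : ℝ) {P : R} (hP : IsSelfAdjoint P) :
    star (twist d r P) = twist d (-r) P := by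
  rw [twist, star_add, star_smul, star_smul, star_sub, star_one, hP.star_eq, star_omegaPow,
    star_omegaPow, twist]
  congr 3
  ring

end Twist

lemma eq_mul_of_combination {R : Type*} [Ring R] [Algebra ℂ R] {y : ℂ} (hy : star y * y = 1)
    {a b c q : R} (ha : a = c * (1 + (y * y - 1) • q))
    (h : star y • a + y • b = (y + star y) • c) : b = c * (1 + (star (y * y) - 1) • q) := by
  have hq : star y * (star y * (y * y - 1)) = 1 - star y * star y := by
    linear_combination (star y * y + 1) * hy
  have hc : star y * (y + star y) = 1 + star y * star y := by linear_combination hy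
  have h' := congrArg (star y • ·) h
  simp only [smul_add, smul_smul, hy, one_smul, hc, ha, mul_add, mul_one, mul_smul_comm, hq] at h'
  rw [← eq_sub_iff_add_eq'] at h'
  rw [h', mul_add, mul_smul_comm, mul_one, star_mul']
  module

section Shift

variable {R : Type*} [Ring R] [StarRing R] {d : ℕ} {S P : R}

/-- The projection `P` conjugated by the `j`-th power of `S`. -/
def shiftProj (S P : R) (j : ℕ) : R := star S ^ j * P * S ^ j

/-- A unitary `S` with `S ^ d = 1` that permutes cyclically the `d` pairwise orthogonal projections
`S⁻ʲ P Sʲ`, whose sum is the identity. -/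
structure IsShift (d : ℕ) (S P : R) : Prop where
  star_mul_self : star S * S = 1
  mul_star_self : S * star S = 1
  pow_eq_one : S ^ d = 1
  proj : IsStarProjection P
  orthogonal : ∀ j < d, ∀ k < d, j ≠ k → shiftProj S P j * shiftProj S P k = 0
  sum_eq_one : ∑ j ∈ Finset.range d, shiftProj S P j = 1

lemma star_pow_mul_pow (hS : star S * S = 1) (j : ℕ) : star S ^ j * S ^ j = 1 :=
  pow_mul_pow_eq_one j hS

lemma pow_mul_star_pow (hS : S * star S = 1) (j : ℕ) : S ^ j * star S ^ j = 1 :=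
  pow_mul_pow_eq_one j hS

lemma pow_mul_shiftProj (hS : S * star S = 1) (P : R) (j : ℕ) :
    S ^ j * shiftProj S P j = P * S ^ j := by
  rw [shiftProj, mul_assoc, ← mul_assoc, pow_mul_star_pow hS, one_mul]

lemma isStarProjection_shiftProj (hS : S * star S = 1) (hP : IsStarProjection P) (j : ℕ) :
    IsStarProjection (shiftProj S P j) where
  isIdempotentElem := by
    rw [IsIdempotentElem]
    nth_rw 1 [shiftProj]
    rw [mul_assoc, pow_mul_shiftProj hS, mul_assoc, ← mul_assoc P, hP.isIdempotentElem.eq,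
      ← mul_assoc, shiftProj]
  isSelfAdjoint := by
    rw [IsSelfAdjoint]
    simp only [shiftProj, star_mul, star_pow, star_star, hP.isSelfAdjoint.star_eq, mul_assoc]

lemma mul_eq_zero_of_mul_sum_eq_zero {Q : ℕ → R} (hQ : ∀ j, IsStarProjection (Q j))
    (h : ∀ k < d, Q k * ∑ j ∈ Finset.range k, Q j = 0) {j k : ℕ} (hj : j < d) (hk : k < d)
    (hjk : j ≠ k) : Q j * Q k = 0 := by
  have star_swap : ∀ j k, Q j * Q k = 0 → Q k * Q j = 0 := fun j k hjk ↦ by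
    simpa [(hQ j).isSelfAdjoint.star_eq, (hQ k).isSelfAdjoint.star_eq] using congrArg star hjk
  have lower : ∀ k < d, ∀ j < k, Q k * Q j = 0 := by
    intro k
    induction k using Nat.strong_induction_on with
    | _ k ih =>
      intro hk j hj
      have hsum : (∑ i ∈ Finset.range k, Q i) * Q j = Q j := by
        rw [Finset.sum_mul, Finset.sum_eq_single_of_mem j (Finset.mem_range.2 hj),
          (hQ j).isIdempotentElem.eq]
        intro i hi hij
        rcases hij.lt_or_gt with hij | hij
        · exact star_swap _ _ (ih j hj (hj.trans hk) i hij)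
        · exact ih i (Finset.mem_range.1 hi) ((Finset.mem_range.1 hi).trans hk) j hij
      rw [← hsum, ← mul_assoc, h k hk, zero_mul]
  rcases hjk.lt_or_gt with hjk | hjk
  · exact star_swap _ _ (lower k hk j hjk)
  · exact lower j hj k hjk

variable [Algebra ℂ R]

lemma mul_one_add_smul_mul (hS : S * star S = 1) (P p : R) (z : ℂ) (k : ℕ) :
    S * (1 + z • P) * (S ^ k * (1 + z • p)) =
      S ^ (k + 1) * (1 + z • (p + shiftProj S P k + z • (shiftProj S P k * p))) := by
  have hcomm : (1 + z • P) * S ^ k = S ^ k * (1 + z • shiftProj S P k) := by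
    rw [mul_add, add_mul, mul_smul_comm, pow_mul_shiftProj hS, smul_mul_assoc, mul_one, one_mul]
  calc S * (1 + z • P) * (S ^ k * (1 + z • p))
      = S * ((1 + z • P) * S ^ k) * (1 + z • p) := by simp only [mul_assoc]
    _ = S ^ (k + 1) * ((1 + z • shiftProj S P k) * (1 + z • p)) := by
      rw [hcomm, pow_succ']
      simp only [mul_assoc]
    _ = _ := by
      congr 1
      simp only [mul_add, add_mul, smul_mul_assoc, mul_smul_comm, one_mul, mul_one]
      module

/-- Comparing the powers for both values of `z` isolates the terms linear and quadratic in `z`. -/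
lemma mul_eq_zero_and_succ_eq_of_pow_eq (hS : star S * S = 1) (hS' : S * star S = 1) {p : ℕ → R}
    {s t : ℂ} (hs : s ≠ 0) (ht : t ≠ 0) (hst : s ≠ t)
    (h : ∀ z ∈ ({s, t} : Set ℂ), ∀ k ≤ d, (S * (1 + z • P)) ^ k = S ^ k * (1 + z • p k))
    {k : ℕ} (hk : k < d) :
    shiftProj S P k * p k = 0 ∧ p (k + 1) = p k + shiftProj S P k := by
  have step : ∀ z ∈ ({s, t} : Set ℂ), z ≠ 0 →
      p (k + 1) = p k + shiftProj S P k + z • (shiftProj S P k * p k) := by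
    intro z hz hz0
    have hpow := h z hz (k + 1) hk
    rw [pow_succ', h z hz k hk.le, mul_one_add_smul_mul hS'] at hpow
    have hcancel := congrArg (star S ^ (k + 1) * ·) hpow
    simp only [← mul_assoc, star_pow_mul_pow hS, one_mul, add_right_inj] at hcancel
    exact (smul_right_injective R hz0 hcancel).symm
  have hs' := step s (by simp) hs
  have hquad : (s - t) • (shiftProj S P k * p k) = 0 := by
    rw [sub_smul, sub_eq_zero]
    exact add_left_cancel (hs'.symm.trans (step t (by simp) ht))
  have hzero := (smul_eq_zero.1 hquad).resolve_left (sub_ne_zero.2 hst)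
  exact ⟨hzero, by rw [hs', hzero, smul_zero, add_zero]⟩

lemma isShift_of_pow_eq (hS : star S * S = 1) (hS' : S * star S = 1) (hSd : S ^ d = 1)
    (hP : IsStarProjection P) {p : ℕ → R} (hpd : p d = 1) {s t : ℂ} (hs : s ≠ 0) (ht : t ≠ 0)
    (hst : s ≠ t)
    (h : ∀ z ∈ ({s, t} : Set ℂ), ∀ k ≤ d, (S * (1 + z • P)) ^ k = S ^ k * (1 + z • p k)) :
    IsShift d S P := by
  have step := fun k (hk : k < d) ↦ mul_eq_zero_and_succ_eq_of_pow_eq hS hS' hs ht hst h hk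
  have hp0 : p 0 = 0 := by
    simpa [hs] using h s (by simp) 0 d.zero_le
  have hp : ∀ k ≤ d, p k = ∑ j ∈ Finset.range k, shiftProj S P j := by
    intro k
    induction k with
    | zero => simp [hp0]
    | succ k ih => intro hk; rw [(step k hk).2, ih (by omega), Finset.sum_range_succ]
  have hmul : ∀ k < d, shiftProj S P k * ∑ j ∈ Finset.range k, shiftProj S P j = 0 :=
    fun k hk ↦ by rw [← hp k hk.le, (step k hk).1]
  exact ⟨hS, hS', hSd, hP, fun j hj k hk hjk ↦ mul_eq_zero_of_mul_sum_eq_zero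
    (isStarProjection_shiftProj hS' hP) hmul hj hk hjk, by rw [← hp d le_rfl, hpd]⟩

variable [StarModule ℂ R]

lemma isStarProjection_of_isometry {u : ℂ} (hu : star u * u = 1) (hu' : star u ≠ u)
    (h : ∀ z ∈ ({u, star u} : Set ℂ), star (1 + (z - 1) • P) * (1 + (z - 1) • P) = 1) :
    IsStarProjection P := by
  have expand : ∀ z : ℂ, star z * z = 1 → star (1 + (z - 1) • P) * (1 + (z - 1) • P) = 1 →
      (z - 1) • P + (star z - 1) • star P + (2 - z - star z) • (star P * P) = 0 := by
    intro z hz h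
    have hz' : (star z - 1) * (z - 1) = 2 - z - star z := by linear_combination hz
    rw [← sub_eq_zero] at h
    rw [← h, ← hz']
    simp only [star_add, star_smul, star_sub, star_one, mul_add, add_mul, smul_mul_assoc,
      mul_smul_comm, one_mul, mul_one]
    module
  have h₁ := expand u hu (h u (by simp))
  have h₂ := expand (star u) (by rw [star_star, mul_comm, hu]) (h (star u) (by simp))
  rw [star_star] at h₂
  have hstar : star P = P := by
    have hsub : (star u - u) • (star P - P) = 0 := by
      rw [← sub_eq_zero.2 (h₁.trans h₂.symm)]
      module
    exact sub_eq_zero.1 ((smul_eq_zero.1 hsub).resolve_left (sub_ne_zero.2 hu'))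
  refine ⟨?_, hstar⟩
  have hidem : (2 - u - star u) • (P * P - P) = 0 := by
    rw [hstar] at h₁
    rw [← h₁]
    module
  have hne : 2 - u - star u ≠ 0 := by
    intro h0
    have hsq : (u - 1) * (u - 1) = 0 := by linear_combination -hu - u * h0
    have hu1 : u = 1 := sub_eq_zero.1 (mul_self_eq_zero.1 hsq)
    exact hu' (by rw [hu1, star_one])
  exact sub_eq_zero.1 ((smul_eq_zero.1 hidem).resolve_left hne)

lemma exists_isShift_of_combination (hd : d ≠ 0) {y : ℂ} (hy : star y * y = 1)
    (hy' : star (y * y) ≠ y * y) {A B C : R} (hA : star A * A = 1) (hB : star B * B = 1)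
    (hC : star C * C = 1) (hC' : C * star C = 1) (hCd : C ^ d = 1)
    (hAd : A ^ d = (y * y) • (1 : R))
    (h : ∀ k ≤ d, star y • A ^ k + y • B ^ k = (y + star y) • C ^ k) :
    ∃ P, IsShift d C P ∧ A = C * (1 + (y * y - 1) • P) ∧
      B = C * (1 + (star (y * y) - 1) • P) := by
  set u := y * y
  have hstar : star u = star y * star y := star_mul' y y
  have hu : star u * u = 1 := by
    rw [hstar]
    linear_combination (star y * y + 1) * hy
  have hu1 : u - 1 ≠ 0 := fun h0 ↦ hy' (by rw [sub_eq_zero.1 h0, star_one])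
  have hu1' : star u - 1 ≠ 0 := fun h0 ↦
    hy' (by rw [← star_star u, sub_eq_zero.1 h0, star_one, star_one])
  obtain ⟨p, hAk⟩ : ∃ p : ℕ → R, ∀ k, A ^ k = C ^ k * (1 + (u - 1) • p k) :=
    ⟨fun k ↦ (u - 1)⁻¹ • (star C ^ k * A ^ k - 1), fun k ↦ by
      rw [smul_inv_smul₀ hu1, add_sub_cancel, ← mul_assoc, pow_mul_star_pow hC', one_mul]⟩
  have hBk : ∀ k ≤ d, B ^ k = C ^ k * (1 + (star u - 1) • p k) := fun k hk ↦
    eq_mul_of_combination hy (hAk k) (h k hk)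
  have hA1 : A = C * (1 + (u - 1) • p 1) := by simpa only [pow_one] using hAk 1
  have hB1 : B = C * (1 + (star u - 1) • p 1) := by
    simpa only [pow_one] using hBk 1 (Nat.one_le_iff_ne_zero.2 hd)
  have isometry : ∀ X : R, star (C * X) * (C * X) = 1 → star X * X = 1 := fun X hX ↦ by
    rwa [star_mul, mul_assoc, ← mul_assoc (star C), hC, one_mul] at hX
  have hP : IsStarProjection (p 1) := by
    refine isStarProjection_of_isometry hu hy' ?_
    rintro z (rfl | rfl)
    · exact isometry _ (hA1 ▸ hA)
    · exact isometry _ (hB1 ▸ hB)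
  refine ⟨p 1, isShift_of_pow_eq (p := p) hC hC' hCd hP ?_ hu1 hu1' (mt sub_left_inj.1 hy'.symm) ?_,
    hA1, hB1⟩
  · have hd' := hAk d
    rw [hAd, hCd, one_mul] at hd'
    refine smul_right_injective R hu1 ?_
    simp only [sub_smul u 1 (1 : R), one_smul, hd', add_sub_cancel_left]
  · rintro z (rfl | rfl) k hk
    · rw [← hA1, hAk]
    · rw [← hB1, hBk k hk]

end Shift

/-! ### The coefficients of the Bell expression -/

section Coefficients

variable {m d : ℕ}

lemma cos_pi_div_two_mul_pos (hm : 2 ≤ m) : 0 < Real.cos (Real.pi / (2 * m)) := by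
  have hm' : (2 : ℝ) ≤ m := by exact_mod_cast hm
  refine Real.cos_pos_of_mem_Ioo ⟨?_, ?_⟩
  · exact (neg_neg_of_pos (by positivity)).trans (by positivity)
  · apply div_lt_div_of_pos_left Real.pi_pos <;> linarith

lemma star_aCoeff (m d k : ℕ) : star (aCoeff m d k) =
    omegaPow d (-((2 * k - d) / (4 * m))) / ((2 * Real.cos (Real.pi / (2 * m)) : ℝ) : ℂ) := by
  rw [aCoeff, star_div₀, star_omegaPow, Complex.star_def, Complex.conj_ofReal]

lemma two_mul_cos_mul_aCoeff (hm : 2 ≤ m) (d k : ℕ) :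
    ((2 * Real.cos (Real.pi / (2 * m)) : ℝ) : ℂ) * aCoeff m d k =
      omegaPow d (k * (1 / (2 * m)) - d / 2 * (1 / (2 * m))) := by
  have hcos := cos_pi_div_two_mul_pos hm
  rw [aCoeff, mul_div_cancel₀ _ (by exact_mod_cast (mul_pos two_pos hcos).ne')]
  congr 1
  field_simp
  ring

lemma two_mul_cos_mul_star_aCoeff (hm : 2 ≤ m) (d k : ℕ) :
    ((2 * Real.cos (Real.pi / (2 * m)) : ℝ) : ℂ) * star (aCoeff m d k) =
      omegaPow d (-(k * (1 / (2 * m)) - d / 2 * (1 / (2 * m)))) := by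
  rw [← star_omegaPow, ← two_mul_cos_mul_aCoeff hm, star_mul', Complex.star_def,
    Complex.conj_ofReal]

lemma aCoeff_sub_self {k : ℕ} (hk : k ≤ d) : aCoeff m d (d - k) = star (aCoeff m d k) := by
  rw [star_aCoeff, aCoeff, Nat.cast_sub hk]
  congr 2
  ring

lemma aCoeff_mul_omegaPow_add (hd : d ≠ 0) (hm : 2 ≤ m) {k : ℕ} {c : ℝ} (hc : c = k ∨ c = k - d)
    (r : ℝ) :
    aCoeff m d k * omegaPow d (c * (r - 1 / (2 * m))) +
        star (aCoeff m d k) * omegaPow d (c * (r + 1 / (2 * m))) = omegaPow d (c * r) := by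
  have hcos : ((2 * Real.cos (Real.pi / (2 * m)) : ℝ) : ℂ) ≠ 0 := by
    exact_mod_cast (mul_pos two_pos (cos_pi_div_two_mul_pos hm)).ne'
  refine mul_left_cancel₀ hcos ?_
  rw [mul_add, ← mul_assoc, ← mul_assoc, two_mul_cos_mul_aCoeff hm,
    two_mul_cos_mul_star_aCoeff hm, ← mul_one_div Real.pi, ← omegaPow_half_dim_mul_add_neg hd,
    add_mul, ← omegaPow_add, ← omegaPow_add, ← omegaPow_add, ← omegaPow_add]
  rcases hc with rfl | rfl
  · rw [add_comm]
    congr 2 <;> ring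
  · congr 2 <;> ring

end Coefficients

section FirstParty

variable {R : Type*} [Ring R] [Algebra ℂ R] {m d : ℕ}

lemma aCoeff_smul_twist_add (hd : d ≠ 0) (hm : 2 ≤ m) (r : ℝ) (P : R) :
    aCoeff m d 1 • twist d (r - 1 / (2 * m)) P +
        star (aCoeff m d 1) • twist d (r + 1 / (2 * m)) P = twist d r P := by
  have hc : ((2 * Real.cos (Real.pi / (2 * m)) : ℝ) : ℂ) ≠ 0 := by
    exact_mod_cast (mul_pos two_pos (cos_pi_div_two_mul_pos hm)).ne'
  have h := smul_twist_add_smul_twist d r (1 / (2 * m)) P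
  rw [omegaPow_half_dim_mul_add_neg hd, mul_one_div Real.pi] at h
  refine smul_right_injective R hc ?_
  simp only [smul_add, smul_smul, two_mul_cos_mul_aCoeff hm, two_mul_cos_mul_star_aCoeff hm,
    Nat.cast_one, ← sub_mul, h]

variable [StarRing R] [StarModule ℂ R]

lemma star_omegaPow_smul_mul_self (r : ℝ) {A : R} (hA : star A * A = 1) :
    star (omegaPow d r • A) * (omegaPow d r • A) = 1 := by
  rw [star_smul, smul_mul_smul_comm, hA, star_omegaPow, omegaPow_neg_mul, one_smul]

lemma exists_isShift_of_aCoeff (hd : d ≠ 0) (hm : 2 ≤ m) {A B C : R} (hA : star A * A = 1)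
    (hB : star B * B = 1) (hAd : A ^ d = 1) (hBd : B ^ d = 1) (hC : star C * C = 1)
    (hC' : C * star C = 1) (hCd : C ^ d = 1)
    (h : ∀ k, 1 ≤ k → k < d → aCoeff m d k • A ^ k + star (aCoeff m d k) • B ^ k = C ^ k) :
    ∃ P, IsShift d C P ∧ A = C * twist d (-(1 / (2 * m))) P ∧
      B = C * twist d (1 / (2 * m)) P := by
  set s : ℝ := 1 / (2 * m) with hs
  set y : ℂ := omegaPow d (d / 2 * s) with hy_def
  have hy : star y * y = 1 := by rw [star_omegaPow, omegaPow_neg_mul]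
  have hyy : y * y = omegaPow d (d * s) := by
    rw [hy_def, ← omegaPow_add]
    ring_nf
  have hcos : y + star y = ((2 * Real.cos (Real.pi / (2 * m)) : ℝ) : ℂ) := by
    rw [star_omegaPow, omegaPow_half_dim_mul_add_neg hd, hs, mul_one_div]
  have hu : star (y * y) ≠ y * y := by
    rw [hyy]
    refine star_omegaPow_dim_mul_ne_self hd (by positivity) ?_
    rw [hs, mul_one_div, div_lt_one (by positivity)]
    exact_mod_cast (by omega : 2 < 2 * m)
  have hAd' : (omegaPow d s • A) ^ d = (y * y) • (1 : R) := by
    rw [smul_pow, hAd, omegaPow_pow, hyy]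
  have hBd' : (omegaPow d (-s) • B) ^ d = star (y * y) • (1 : R) := by
    rw [smul_pow, hBd, omegaPow_pow, hyy, star_omegaPow, mul_neg]
  have hcomb : ∀ k ≤ d, star y • (omegaPow d s • A) ^ k + y • (omegaPow d (-s) • B) ^ k =
      (y + star y) • C ^ k := by
    intro k hk
    rcases k.eq_zero_or_pos with rfl | hk0
    · simp only [pow_zero, ← add_smul, add_comm]
    rcases hk.eq_or_lt with rfl | hkd
    · rw [hAd', hBd', hCd, smul_smul, smul_smul, ← add_smul, star_mul']
      congr 1
      linear_combination (y + star y) * hy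
    · rw [← h k hk0 hkd, hcos, smul_add, smul_smul, smul_smul, two_mul_cos_mul_aCoeff hm,
        two_mul_cos_mul_star_aCoeff hm, smul_pow, smul_pow, smul_smul, smul_smul, omegaPow_pow,
        omegaPow_pow, hy_def, star_omegaPow, ← omegaPow_add, ← omegaPow_add]
      congr 3 <;> (rw [hs]; ring)
  obtain ⟨P, hP, hAP, hBP⟩ := exists_isShift_of_combination hd hy hu
    (star_omegaPow_smul_mul_self s hA) (star_omegaPow_smul_mul_self (-s) hB) hC hC' hCd hAd' hcomb
  refine ⟨P, hP, ?_, ?_⟩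
  · rw [twist_eq, mul_smul_comm, mul_neg, neg_neg, ← hyy, ← hAP, smul_smul, omegaPow_neg_mul,
      one_smul]
  · rw [twist_eq, mul_smul_comm, ← star_omegaPow, ← hyy, ← hBP, smul_smul, omegaPow_mul_neg,
      one_smul]

end FirstParty

/-! ### The ideal observables -/

section RootsOfUnity

variable {d : ℕ}

lemma omegaPow_intCast (d : ℕ) (z : ℤ) : omegaPow d z = omegaPow d 1 ^ z := by
  rw [omegaPow, omegaPow, ← Complex.exp_int_mul]
  congr 1
  push_cast
  ring

lemma isPrimitiveRoot_omegaPow_one (hd : d ≠ 0) : IsPrimitiveRoot (omegaPow d 1) d := by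
  simpa [omegaPow] using Complex.isPrimitiveRoot_exp d hd

lemma omegaPow_intCast_eq_one_iff (hd : d ≠ 0) (z : ℤ) : omegaPow d z = 1 ↔ (d : ℤ) ∣ z := by
  rw [omegaPow_intCast, (isPrimitiveRoot_omegaPow_one hd).zpow_eq_one_iff_dvd]

lemma sum_omegaPow_mul (hd : d ≠ 0) (z : ℤ) :
    ∑ c : Fin d, omegaPow d ((c : ℕ) * (z : ℝ)) = if (d : ℤ) ∣ z then (d : ℂ) else 0 := by
  simp only [← omegaPow_pow]
  rw [Fin.sum_univ_eq_sum_range (fun c ↦ omegaPow d z ^ c)]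
  split_ifs with h
  · simp [(omegaPow_intCast_eq_one_iff hd z).2 h]
  · have hroot : omegaPow d z ^ d = 1 := by
      rw [omegaPow_pow]
      exact_mod_cast (omegaPow_intCast_eq_one_iff hd (d * z)).2 (dvd_mul_right _ _)
    rw [geom_sum_eq (mt (omegaPow_intCast_eq_one_iff hd z).1 h), hroot, sub_self, zero_div]

end RootsOfUnity

section IdealMatrices

variable {d : ℕ}

/-- The cyclic shift `|j⟩ ↦ |j - 1⟩` of the standard basis, which is `F Ω F†`. -/
noncomputable def lower (d : ℕ) : Matrix (Fin d) (Fin d) ℂ :=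
  Matrix.of fun a b ↦ if (b : ℕ) = (a + 1) % d then 1 else 0

/-- The projection on the first basis vector: the model of the projection in `IsShift`. -/
noncomputable def firstProj (d : ℕ) : Matrix (Fin d) (Fin d) ℂ :=
  Matrix.diagonal fun j ↦ if (j : ℕ) = 0 then 1 else 0

lemma lower_apply (a b : Fin d) : lower d a b = if (b : ℕ) = (a + 1) % d then 1 else 0 := rfl

lemma dvd_succ_sub_iff (a b : Fin d) :
    (d : ℤ) ∣ ((a : ℕ) + 1 - (b : ℕ) : ℤ) ↔ (b : ℕ) = (a + 1) % d := by
  have hmod : (b : ℕ) = (a + 1) % d ↔ (b : ℕ) ≡ a + 1 [MOD d] := by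
    rw [Nat.ModEq, Nat.mod_eq_of_lt b.isLt]
  rw [hmod, Nat.modEq_iff_dvd]
  push_cast
  rfl

lemma one_div_sqrt_mul_self (d : ℕ) :
    ((1 / Real.sqrt d : ℝ) : ℂ) * ((1 / Real.sqrt d : ℝ) : ℂ) = 1 / d := by
  rw [← Complex.ofReal_mul, div_mul_div_comm, Real.mul_self_sqrt (Nat.cast_nonneg d)]
  simp

lemma fourier_mul_clock_mul (hd : d ≠ 0) : fourier d * clock d * (fourier d)ᴴ = lower d := by
  have hd' : (d : ℂ) ≠ 0 := by exact_mod_cast hd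
  ext a b
  have hterm : ∀ c : Fin d, (fourier d * clock d) a c * (fourier d)ᴴ c b =
      1 / d * omegaPow d ((c : ℕ) * (((a : ℕ) + 1 - (b : ℕ) : ℤ) : ℝ)) := by
    intro c
    rw [clock, phase, mul_diagonal, conjTranspose_apply, fourier, of_apply, of_apply, star_mul',
      star_omegaPow, Complex.star_def, Complex.conj_ofReal, mul_right_comm, mul_mul_mul_comm,
      one_div_sqrt_mul_self, mul_assoc, ← omegaPow_add, ← omegaPow_add]
    congr 2
    push_cast
    ring
  rw [Matrix.mul_apply, Finset.sum_congr rfl fun c _ ↦ hterm c, ← Finset.mul_sum,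
    sum_omegaPow_mul hd, if_congr (dvd_succ_sub_iff a b) rfl rfl, lower_apply]
  split_ifs <;> simp [hd']

lemma conjTranspose_fourier_mul_clock_mul (hd : d ≠ 0) :
    (fourier d)ᴴ * clock d * fourier d = (lower d)ᴴ := by
  have hF : (fourier d)ᵀ = fourier d := by
    ext a b
    simp only [fourier, transpose_apply, of_apply, mul_comm]
  have hC : (clock d)ᵀ = clock d := diagonal_transpose _
  have hF' : (fourier d)ᴴᵀ = (fourier d)ᴴ := by
    rw [conjTranspose, hF, ← transpose_map, hF]
  have hL : (lower d)ᴴ = (lower d)ᵀ := by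
    ext a b
    rw [conjTranspose_apply, transpose_apply, lower_apply]
    split_ifs <;> simp
  rw [hL, ← fourier_mul_clock_mul hd, transpose_mul, transpose_mul, hC, hF, hF', Matrix.mul_assoc]

lemma phase_mul_phase (d : ℕ) (r s : ℝ) : phase d r * phase d s = phase d (r + s) := by
  simp only [phase, diagonal_mul_diagonal, ← omegaPow_add, mul_add]

lemma phase_zero (d : ℕ) : phase d 0 = 1 := by
  simp [phase, omegaPow_zero]

lemma conjTranspose_phase (d : ℕ) (r : ℝ) : (phase d r)ᴴ = phase d (-r) := by
  rw [phase, diagonal_conjTranspose, phase]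
  congr 1
  ext j
  rw [Pi.star_apply, star_omegaPow, mul_neg]

/-- The cyclic shift conjugated by a diagonal phase: the form of all ideal observables, up to the
adjoint. -/
noncomputable def lowerPhase (d : ℕ) (r : ℝ) : Matrix (Fin d) (Fin d) ℂ :=
  phase d (-r) * lower d * phase d r

lemma lowerPhase_apply (r : ℝ) (a b : Fin d) :
    lowerPhase d r a b = if (b : ℕ) = (a + 1) % d then omegaPow d (((b : ℝ) - a) * r) else 0 := by
  rw [lowerPhase, phase, phase, mul_diagonal, diagonal_mul, lower_apply]
  split_ifs
  · rw [mul_one, ← omegaPow_add]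
    congr 1
    ring
  · simp

lemma phase_conj_lowerPhase (d : ℕ) (r s : ℝ) :
    phase d (-s) * lowerPhase d r * phase d s = lowerPhase d (r + s) := by
  rw [lowerPhase, lowerPhase, ← phase_mul_phase, neg_add_rev, ← phase_mul_phase]
  simp only [Matrix.mul_assoc]

lemma conjTranspose_lowerPhase (d : ℕ) (r : ℝ) :
    (lowerPhase d r)ᴴ = phase d (-r) * (lower d)ᴴ * phase d r := by
  rw [lowerPhase, conjTranspose_mul, conjTranspose_mul, conjTranspose_phase, conjTranspose_phase,
    neg_neg, Matrix.mul_assoc]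

lemma idealObs_eq {m : ℕ} (hd : d ≠ 0) (i x : ℕ) :
    idealObs m d i x =
      if i = 0 then lowerPhase d ((x + 1) / m - 1 / (2 * m))
      else if i = 1 then (lowerPhase d (-((x + 1) / m)))ᴴ
      else if Even i then lowerPhase d (x / m) else (lowerPhase d (-(x / m)))ᴴ := by
  simp only [idealObs, conjTranspose_lowerPhase, ← conjTranspose_fourier_mul_clock_mul hd]
  simp only [lowerPhase, ← fourier_mul_clock_mul hd, conjTranspose_phase, neg_neg,
    Matrix.mul_assoc]

lemma twist_firstProj (r : ℝ) : twist d r (firstProj d) =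
    diagonal fun j : Fin d ↦ if (j : ℕ) = 0 then omegaPow d (r - d * r) else omegaPow d r := by
  ext a b
  simp only [twist, firstProj, Matrix.add_apply, Matrix.smul_apply, Matrix.sub_apply,
    Matrix.one_apply, diagonal_apply, smul_eq_mul]
  split_ifs <;> simp

lemma lower_mul_twist (r : ℝ) : lower d * twist d r (firstProj d) = lowerPhase d r := by
  ext a b
  rw [twist_firstProj, mul_diagonal, lowerPhase_apply, lower_apply]
  by_cases h : (b : ℕ) = (a + 1) % d
  swap
  · rw [if_neg h, if_neg h, zero_mul]
  rw [if_pos h, if_pos h, one_mul]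
  rcases (Nat.succ_le_of_lt a.isLt).lt_or_eq with hlt | heq
  · rw [Nat.mod_eq_of_lt hlt] at h
    rw [if_neg (by omega), h]
    congr 1
    push_cast
    ring
  · rw [← Nat.succ_eq_add_one, heq, Nat.mod_self] at h
    rw [if_pos h, h, show (d : ℝ) = (a : ℕ) + 1 by exact_mod_cast heq.symm]
    congr 1
    push_cast
    ring

lemma phase_mul_firstProj (d : ℕ) (r s : ℝ) :
    phase d r * firstProj d * phase d s = firstProj d := by
  rw [phase, phase, firstProj, diagonal_mul_diagonal, diagonal_mul_diagonal]
  congr 1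
  ext j
  split_ifs with h
  · simp [h, omegaPow_zero]
  · simp

lemma twist_kronecker_one {D : ℕ} (r : ℝ) (E : Matrix (Fin d) (Fin d) ℂ) :
    twist d r (E ⊗ₖ (1 : Matrix (Fin D) (Fin D) ℂ)) = twist d r E ⊗ₖ 1 := by
  ext p q
  rw [twist, ← one_kronecker_one]
  simp only [twist, Matrix.add_apply, Matrix.smul_apply, Matrix.sub_apply, kroneckerMap_apply,
    smul_eq_mul]
  ring

end IdealMatrices

/-! ### Shifts are ideal up to a unitary -/

section Realisation

variable {n κ : Type*} [Fintype n]

lemma exists_isometry_of_isStarProjection {P : Matrix n n ℂ} (hP : IsStarProjection P) :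
    ∃ (D : ℕ) (V : Matrix n (Fin D) ℂ), Vᴴ * V = 1 ∧ V * Vᴴ = P := by
  classical
  have hH : P.IsHermitian := hP.isSelfAdjoint
  set W : Matrix n n ℂ := hH.eigenvectorUnitary.val
  have hWW : Wᴴ * W = 1 := Unitary.coe_star_mul_self hH.eigenvectorUnitary
  have hspec : P = W * diagonal (RCLike.ofReal ∘ hH.eigenvalues) * Wᴴ := by
    have := hH.spectral_theorem
    rwa [Unitary.conjStarAlgAut_apply] at this
  have heig : ∀ i, hH.eigenvalues i = 0 ∨ hH.eigenvalues i = 1 := fun i ↦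
    hP.isIdempotentElem.spectrum_subset ℝ (hH.eigenvalues_mem_spectrum_real i)
  let e : Fin (Fintype.card {i // hH.eigenvalues i = 1}) ≃ {i // hH.eigenvalues i = 1} :=
    (Fintype.equivFin _).symm
  refine ⟨_, W.submatrix id fun s ↦ (e s : n), ?_, ?_⟩
  · have hinj : Function.Injective fun s ↦ (e s : n) :=
      Subtype.val_injective.comp e.injective
    rw [conjTranspose_submatrix, ← submatrix_mul _ _ _ _ _ Function.bijective_id, hWW,
      submatrix_one _ hinj]
  · refine Eq.trans ?_ hspec.symm
    ext a b
    rw [Matrix.mul_apply, Matrix.mul_apply]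
    simp only [mul_diagonal, submatrix_apply, conjTranspose_apply, id]
    rw [e.sum_comp (fun s : {i // hH.eigenvalues i = 1} ↦ W a s * star (W b s)),
      ← Finset.sum_subtype (Finset.univ.filter fun i ↦ hH.eigenvalues i = 1) (by simp)
        (fun i ↦ W a i * star (W b i)), Finset.sum_filter]
    refine Finset.sum_congr rfl fun i _ ↦ ?_
    rcases heig i with h | h <;> simp [h]

lemma exists_unitary_reindex [Fintype κ] [DecidableEq n] [DecidableEq κ] {T : Matrix n κ ℂ}
    (hT : Tᴴ * T = 1) (hT' : T * Tᴴ = 1) :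
    ∃ (e : n ≃ κ) (U : Matrix n n ℂ), U ∈ Matrix.unitaryGroup n ℂ ∧
      ∀ X, Matrix.reindex e e (U * X * Uᴴ) = Tᴴ * X * T := by
  have hcard : Fintype.card n = Fintype.card κ := by
    have htrace := Matrix.trace_mul_comm T Tᴴ
    rw [hT, hT', Matrix.trace_one, Matrix.trace_one] at htrace
    exact_mod_cast htrace
  let e : n ≃ κ := Fintype.equivOfCardEq hcard
  refine ⟨e, (T.submatrix id e)ᴴ, ?_, fun X ↦ ?_⟩
  · rw [Matrix.mem_unitaryGroup_iff', star_eq_conjTranspose, conjTranspose_conjTranspose,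
      conjTranspose_submatrix, submatrix_mul_equiv, hT', submatrix_id_id]
  · rw [conjTranspose_conjTranspose]
    ext p q
    simp [Matrix.mul_apply]

/-- The matrix with the columns `S⁻ʲ v` for `j < d` and the columns `v` of `V`. If the columns of
`V` form an orthonormal basis of the range of the projection of a shift `S`, these form an
orthonormal basis of the whole space in which `S` is the ideal cyclic shift. -/
def shiftBasis [DecidableEq n] (d : ℕ) (S : Matrix n n ℂ) (V : Matrix n κ ℂ) :
    Matrix n (Fin d × κ) ℂ :=
  Matrix.of fun a p ↦ (star S ^ (p.1 : ℕ) * V) a p.2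

variable [DecidableEq n] {d : ℕ} {S P : Matrix n n ℂ} {V : Matrix n κ ℂ}

lemma conjTranspose_star_pow_mul (S : Matrix n n ℂ) (V : Matrix n κ ℂ) (j : ℕ) :
    (star S ^ j * V)ᴴ = Vᴴ * S ^ j := by
  rw [conjTranspose_mul, ← star_eq_conjTranspose (star S ^ _), star_pow, star_star]

lemma conj_shiftBasis_apply (X : Matrix n n ℂ) (p q : Fin d × κ) :
    ((shiftBasis d S V)ᴴ * X * shiftBasis d S V) p q =
      (Vᴴ * (S ^ (p.1 : ℕ) * X * star S ^ (q.1 : ℕ)) * V) p.2 q.2 := by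
  calc ((shiftBasis d S V)ᴴ * X * shiftBasis d S V) p q
      = ((star S ^ (p.1 : ℕ) * V)ᴴ * X * (star S ^ (q.1 : ℕ) * V)) p.2 q.2 := by
        simp only [Matrix.mul_apply (M := _ * _), Matrix.mul_apply (M := (_)ᴴ)]
        rfl
    _ = _ := by
        rw [conjTranspose_star_pow_mul]
        simp only [Matrix.mul_assoc]

variable [Fintype κ]

lemma IsShift.shiftBasis_mul_conjTranspose (h : IsShift d S P) (hVP : V * Vᴴ = P) :
    shiftBasis d S V * (shiftBasis d S V)ᴴ = 1 := by
  rw [← h.sum_eq_one, ← Fin.sum_univ_eq_sum_range]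
  ext a b
  rw [Matrix.mul_apply, Fintype.sum_prod_type, Matrix.sum_apply]
  refine Finset.sum_congr rfl fun j _ ↦ ?_
  rw [shiftProj, ← hVP, ← Matrix.mul_assoc, Matrix.mul_assoc, ← conjTranspose_star_pow_mul,
    Matrix.mul_apply]
  rfl

variable [DecidableEq κ]

lemma IsShift.gram (h : IsShift d S P) (hV : Vᴴ * V = 1) (hVP : V * Vᴴ = P) {j k : ℕ}
    (hj : j < d) (hk : k < d) :
    Vᴴ * (S ^ j * star S ^ k) * V = if j = k then 1 else 0 := by
  split_ifs with hjk
  · rw [hjk, pow_mul_star_pow h.mul_star_self, Matrix.mul_one, hV]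
  · have horth : Vᴴ * (S ^ j * (shiftProj S P j * shiftProj S P k) * star S ^ k) * V = 0 := by
      rw [h.orthogonal j hj k hk hjk, Matrix.mul_zero, Matrix.zero_mul, Matrix.mul_zero,
        Matrix.zero_mul]
    calc Vᴴ * (S ^ j * star S ^ k) * V
        = Vᴴ * V * Vᴴ * (S ^ j * star S ^ k) * (V * (Vᴴ * V)) := by
          rw [hV, Matrix.one_mul, Matrix.mul_one]
      _ = Vᴴ * (S ^ j * star S ^ j * P * S ^ j * (star S ^ k * P * (S ^ k * star S ^ k))) * V := by
          rw [pow_mul_star_pow h.mul_star_self, pow_mul_star_pow h.mul_star_self, ← hVP]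
          simp only [Matrix.mul_assoc, Matrix.one_mul, Matrix.mul_one]
      _ = 0 := by
          rw [← horth, shiftProj, shiftProj]
          simp only [Matrix.mul_assoc]

lemma IsShift.conj_shiftBasis_one (h : IsShift d S P) (hV : Vᴴ * V = 1) (hVP : V * Vᴴ = P) :
    (shiftBasis d S V)ᴴ * shiftBasis d S V = 1 := by
  ext p q
  rw [← Matrix.mul_one (shiftBasis d S V)ᴴ, conj_shiftBasis_apply, Matrix.mul_one,
    h.gram hV hVP p.1.isLt q.1.isLt, Matrix.one_apply]
  by_cases hpq : p.1 = q.1 <;> simp [hpq, Matrix.one_apply, Prod.ext_iff, Fin.val_inj]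

lemma IsShift.conj_shiftBasis_self (h : IsShift d S P) (hV : Vᴴ * V = 1) (hVP : V * Vᴴ = P) :
    (shiftBasis d S V)ᴴ * S * shiftBasis d S V = lower d ⊗ₖ (1 : Matrix κ κ ℂ) := by
  ext p q
  rw [conj_shiftBasis_apply, ← pow_succ, pow_eq_pow_mod _ h.pow_eq_one,
    h.gram hV hVP (Nat.mod_lt _ p.1.pos) q.1.isLt, kroneckerMap_apply, lower_apply,
    if_congr eq_comm rfl rfl]
  split_ifs <;> simp

lemma IsShift.conj_shiftBasis_proj (h : IsShift d S P) (hV : Vᴴ * V = 1) (hVP : V * Vᴴ = P) :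
    (shiftBasis d S V)ᴴ * P * shiftBasis d S V = firstProj d ⊗ₖ (1 : Matrix κ κ ℂ) := by
  ext p q
  have hsplit : Vᴴ * (S ^ (p.1 : ℕ) * P * star S ^ (q.1 : ℕ)) * V =
      Vᴴ * (S ^ (p.1 : ℕ) * star S ^ 0) * V * (Vᴴ * (S ^ 0 * star S ^ (q.1 : ℕ)) * V) := by
    rw [← hVP, pow_zero, pow_zero, Matrix.mul_one, Matrix.one_mul]
    simp only [Matrix.mul_assoc]
  rw [conj_shiftBasis_apply, hsplit, h.gram hV hVP p.1.isLt p.1.pos,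
    h.gram hV hVP p.1.pos q.1.isLt, kroneckerMap_apply, firstProj, diagonal_apply]
  by_cases hp : (p.1 : ℕ) = 0 <;> by_cases hq : (q.1 : ℕ) = 0 <;>
    simp_all [Fin.ext_iff, eq_comm]

lemma IsShift.exists_unitary (h : IsShift d S P) (τ : ℝ) :
    ∃ (D : ℕ) (e : n ≃ Fin d × Fin D) (U : Matrix n n ℂ), U ∈ Matrix.unitaryGroup n ℂ ∧
      (∀ r : ℝ, Matrix.reindex e e (U * (S * twist d r P) * Uᴴ) =
        lowerPhase d (r - τ) ⊗ₖ (1 : Matrix (Fin D) (Fin D) ℂ)) ∧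
      Matrix.reindex e e (U * P * Uᴴ) = firstProj d ⊗ₖ (1 : Matrix (Fin D) (Fin D) ℂ) := by
  obtain ⟨D, V, hV, hVP⟩ := exists_isometry_of_isStarProjection h.proj
  set T := shiftBasis d S V
  have hT : Tᴴ * T = 1 := h.conj_shiftBasis_one hV hVP
  have hT' : T * Tᴴ = 1 := h.shiftBasis_mul_conjTranspose hVP
  set K : ℝ → Matrix (Fin d × Fin D) (Fin d × Fin D) ℂ := fun r ↦ phase d r ⊗ₖ 1 with hK
  have hKK : ∀ r s, K r * K s = K (r + s) := fun r s ↦ by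
    simp only [hK, ← mul_kronecker_mul, phase_mul_phase, Matrix.mul_one]
  have hK0 : K 0 = 1 := by simp only [hK, phase_zero, one_kronecker_one]
  have hKT : (T * K (-τ))ᴴ = K τ * Tᴴ := by
    simp only [hK, conjTranspose_mul, conjTranspose_kronecker, conjTranspose_phase, neg_neg,
      conjTranspose_one]
  obtain ⟨e, U, hU, hUT⟩ := exists_unitary_reindex (T := T * K (-τ))
    (by rw [hKT, Matrix.mul_assoc, ← Matrix.mul_assoc Tᴴ, hT, Matrix.one_mul, hKK,
      add_neg_cancel, hK0])
    (by rw [hKT, Matrix.mul_assoc, ← Matrix.mul_assoc (K _), hKK, neg_add_cancel, hK0,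
      Matrix.one_mul, hT'])
  have hconj : ∀ X, Matrix.reindex e e (U * X * Uᴴ) = K τ * (Tᴴ * X * T) * K (-τ) := fun X ↦ by
    rw [hUT, hKT]
    simp only [Matrix.mul_assoc]
  refine ⟨D, e, U, hU, fun r ↦ ?_, ?_⟩
  · have htwist : Tᴴ * twist d r P * T = twist d r (Tᴴ * P * T) := by
      simp only [twist, Matrix.mul_add, Matrix.mul_sub, Matrix.add_mul, Matrix.sub_mul,
        Matrix.mul_smul, Matrix.smul_mul, Matrix.mul_one, hT]
    have hmul : Tᴴ * (S * twist d r P) * T = Tᴴ * S * T * (Tᴴ * twist d r P * T) := by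
      rw [← Matrix.mul_one S, ← hT']
      simp only [Matrix.mul_assoc, hT, Matrix.mul_one]
    rw [hconj, hmul, htwist, h.conj_shiftBasis_proj hV hVP, h.conj_shiftBasis_self hV hVP,
      twist_kronecker_one, ← mul_kronecker_mul, lower_mul_twist, hK, ← mul_kronecker_mul,
      ← mul_kronecker_mul, Matrix.mul_one, Matrix.mul_one]
    simpa [sub_eq_add_neg] using congrArg (· ⊗ₖ (1 : Matrix (Fin D) (Fin D) ℂ))
      (phase_conj_lowerPhase d r (-τ))
  · rw [hconj, h.conj_shiftBasis_proj hV hVP, hK, ← mul_kronecker_mul, ← mul_kronecker_mul,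
      Matrix.one_mul, Matrix.one_mul, phase_mul_firstProj]

end Realisation

/-! ### The Bell bound and its saturation -/

section Observables

variable {m d : ℕ} {κ : Type*}

lemma extObs_of_lt (A : Fin m → Matrix κ κ ℂ) {q : ℕ} (hq : q < m) :
    extObs d A q = A ⟨q, hq⟩ := by
  rw [extObs, dif_pos (by omega), Nat.div_eq_of_lt hq]
  simp [omegaPow_zero, Nat.mod_eq_of_lt hq]

lemma extObs_self (A : Fin m → Matrix κ κ ℂ) : extObs d A m = omegaPow d 1 • extObs d A 0 := by
  rcases m.eq_zero_or_pos with rfl | hm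
  · simp [extObs]
  · simp [extObs, hm, omegaPow_zero]

variable [Fintype κ] [DecidableEq κ]

lemma IsObservable.star_mul_self {A : Matrix κ κ ℂ} (h : IsObservable d A) : star A * A = 1 :=
  mem_unitaryGroup_iff'.1 h.1

lemma IsObservable.mul_star_self {A : Matrix κ κ ℂ} (h : IsObservable d A) : A * star A = 1 :=
  mem_unitaryGroup_iff.1 h.1

lemma IsObservable.pow_sub_one (hd : d ≠ 0) {A : Matrix κ κ ℂ} (h : IsObservable d A) :
    A ^ (d - 1) = star A := by
  rw [← mul_one (A ^ (d - 1)), ← h.mul_star_self, ← mul_assoc, pow_sub_one_mul hd, h.2, one_mul]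

lemma IsObservable.star {A : Matrix κ κ ℂ} (h : IsObservable d A) : IsObservable d (star A) :=
  ⟨Unitary.star_mem h.1, by rw [← star_pow, h.2, star_one]⟩

lemma isObservable_extObs (hd : d ≠ 0) (hm : m ≠ 0) {A : Fin m → Matrix κ κ ℂ}
    (hA : ∀ x, IsObservable d (A x)) (q : ℕ) : IsObservable d (extObs d A q) := by
  rw [extObs, dif_pos (Nat.pos_of_ne_zero hm)]
  have h := hA ⟨q % m, Nat.mod_lt q (Nat.pos_of_ne_zero hm)⟩
  refine ⟨mem_unitaryGroup_iff'.2 (star_omegaPow_smul_mul_self _ h.star_mul_self), ?_⟩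
  rw [smul_pow, h.2, omegaPow_pow, ← mul_comm, ← omegaPow_pow, omegaPow_dim hd, one_pow, one_smul]

/-- The operator `a_k A_x^k + a_k^* A_{x+1}^k` of the first party. -/
noncomputable def firstFactor (d : ℕ) (A : Fin m → Matrix κ κ ℂ) (k x : ℕ) : Matrix κ κ ℂ :=
  aCoeff m d k • extObs d A x ^ k + star (aCoeff m d k) • extObs d A (x + 1) ^ k

/-- The `k`-th powers of the observables of a party, with phases chosen such that they are
antiperiodic in the setting and `firstFactor` is proportional to the sum of two consecutive ones. -/
noncomputable def phasedPow (d : ℕ) (A : Fin m → Matrix κ κ ℂ) (k x : ℕ) : Matrix κ κ ℂ :=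
  omegaPow d (-((k - d / 2) * (x / m))) • extObs d A x ^ k

lemma star_phasedPow_mul_self (hd : d ≠ 0) (hm : m ≠ 0) {A : Fin m → Matrix κ κ ℂ}
    (hA : ∀ x, IsObservable d (A x)) (k x : ℕ) :
    star (phasedPow d A k x) * phasedPow d A k x = 1 := by
  refine star_omegaPow_smul_mul_self _ ?_
  rw [star_pow, star_pow_mul_pow (isObservable_extObs hd hm hA x).star_mul_self]

lemma phasedPow_self (hd : d ≠ 0) (hm : m ≠ 0) (A : Fin m → Matrix κ κ ℂ) (k : ℕ) :
    phasedPow d A k m = -phasedPow d A k 0 := by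
  have hhalf : omegaPow d (d * (1 / 2)) = -1 := by
    rw [omegaPow_dim_mul hd, show 2 * Real.pi * (1 / 2) = Real.pi by ring, Complex.exp_pi_mul_I]
  rw [phasedPow, phasedPow, extObs_self, smul_pow, smul_smul, omegaPow_pow, ← omegaPow_add,
    show -((k - d / 2) * (m / m)) + (k : ℝ) * 1 = d * (1 / 2) by field_simp; ring, hhalf]
  simp [omegaPow_zero]

lemma two_mul_cos_smul_firstFactor (hm : 2 ≤ m) (A : Fin m → Matrix κ κ ℂ) (k x : ℕ) :
    ((2 * Real.cos (Real.pi / (2 * m)) : ℝ) : ℂ) • firstFactor d A k x =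
      omegaPow d ((k - d / 2) * (x / m + 1 / (2 * m))) •
        (phasedPow d A k x + phasedPow d A k (x + 1)) := by
  simp only [firstFactor, phasedPow, smul_add, smul_smul, two_mul_cos_mul_aCoeff hm,
    two_mul_cos_mul_star_aCoeff hm, ← omegaPow_add]
  congr 3
  · ring
  · push_cast
    field_simp
    ring

lemma star_firstFactor_one (hd : d ≠ 0) (hm : m ≠ 0) {A : Fin m → Matrix κ κ ℂ}
    (hA : ∀ x, IsObservable d (A x)) (x : ℕ) :
    star (firstFactor d A 1 x) = firstFactor d A (d - 1) x := by
  have hpow := fun q ↦ (isObservable_extObs hd hm hA q).pow_sub_one hd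
  rw [firstFactor, firstFactor, aCoeff_sub_self (Nat.one_le_iff_ne_zero.2 hd), hpow, hpow,
    star_star, star_add, star_smul, star_smul, star_star, pow_one, pow_one]

end Observables

section BellBound

universe u

variable {N m d : ℕ} {n : Fin N → Type u} [∀ i, Fintype (n i)] [∀ i, DecidableEq (n i)]
  {A : ∀ i, Fin m → Matrix (n i) (n i) ℂ} {ρ : Matrix (∀ i, n i) (∀ i, n i) ℂ}

lemma settingIndex_zero (hN : 2 ≤ N) (α : Fin (N - 1) → Fin m) :
    settingIndex α 0 = α ⟨0, by omega⟩ := by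
  rw [settingIndex, dif_pos]

lemma sum_settingIndex_zero (hN : 2 ≤ N) (f : ℕ → ℝ) :
    ∑ α : Fin (N - 1) → Fin m, f (settingIndex α 0) =
      (m : ℝ) ^ (N - 2) * ∑ x ∈ Finset.range m, f x := by
  have h := Fintype.sum_piFinset_apply (fun x : Fin m ↦ f x) (Finset.univ : Finset (Fin m))
    (⟨0, by omega⟩ : Fin (N - 1))
  rw [Fintype.piFinset_univ] at h
  simp only [settingIndex_zero hN]
  rw [h, Fin.sum_univ_eq_sum_range, Finset.card_univ, Fintype.card_fin, Fintype.card_fin,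
    nsmul_eq_mul, Nat.cast_pow, Nat.sub_sub]

lemma bellFactor_zero {i : Fin N} (hi : (i : ℕ) = 0) (α : Fin (N - 1) → Fin m) (k : ℕ) :
    bellFactor d A α k i = firstFactor d (A i) k (settingIndex α 0) := by
  rw [bellFactor, if_pos hi, firstFactor]

lemma bellFactor_eq_pow (α : Fin (N - 1) → Fin m) (k : ℕ) {i : Fin N} (hi : (i : ℕ) ≠ 0) :
    bellFactor d A α k i = bellFactor d A α 1 i ^ k := by
  rw [bellFactor, bellFactor, if_neg hi, if_neg hi]
  split_ifs <;> rw [pow_one]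

lemma isObservable_bellFactor_one (hd : d ≠ 0) (hm : m ≠ 0) (hA : ∀ i x, IsObservable d (A i x))
    (α : Fin (N - 1) → Fin m) {i : Fin N} (hi : (i : ℕ) ≠ 0) :
    IsObservable d (bellFactor d A α 1 i) := by
  rw [bellFactor, if_neg hi, pow_one, pow_one]
  split_ifs
  · exact isObservable_extObs hd hm (hA i) _
  · exact (isObservable_extObs hd hm (hA i) _).star

/-- The Bell term `(α, 1)` without the factor of the first party. -/
noncomputable def restTerm (d : ℕ) (A : ∀ i, Fin m → Matrix (n i) (n i) ℂ)
    (α : Fin (N - 1) → Fin m) : Matrix (∀ i, n i) (∀ i, n i) ℂ :=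
  tensor fun i ↦ if (i : ℕ) = 0 then 1 else bellFactor d A α 1 i

lemma tensor_bellFactor {i₀ : Fin N} (hi₀ : (i₀ : ℕ) = 0) (α : Fin (N - 1) → Fin m) (k : ℕ) :
    tensor (bellFactor d A α k) =
      restTerm d A α ^ k * locHom n i₀ (firstFactor d (A i₀) k (settingIndex α 0)) := by
  rw [restTerm, tensor_pow, locHom_apply, tensor_mul]
  congr 1
  ext1 i
  by_cases hi : i = i₀
  · subst hi
    simp [hi₀, bellFactor_zero hi₀]
  · have hi' : (i : ℕ) ≠ 0 := fun h ↦ hi (Fin.ext (h.trans hi₀.symm))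
    simp [hi, hi', bellFactor_eq_pow α k hi']

lemma restTerm_commute_locHom {i₀ : Fin N} (hi₀ : (i₀ : ℕ) = 0) (α : Fin (N - 1) → Fin m)
    (X : Matrix (n i₀) (n i₀) ℂ) : Commute (restTerm d A α) (locHom n i₀ X) := by
  rw [Commute, SemiconjBy, restTerm, locHom_apply, tensor_mul, tensor_mul]
  congr 1
  ext1 i
  by_cases hi : i = i₀
  · subst hi
    simp [hi₀]
  · simp [hi]

lemma isObservable_restTerm (hd : d ≠ 0) (hm : m ≠ 0) (hA : ∀ i x, IsObservable d (A i x))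
    (α : Fin (N - 1) → Fin m) : IsObservable d (restTerm d A α) := by
  refine ⟨?_, ?_⟩
  · rw [mem_unitaryGroup_iff', star_eq_conjTranspose, restTerm, conjTranspose_tensor,
      tensor_mul, ← tensor_one]
    congr 1
    ext1 i
    by_cases hi : (i : ℕ) = 0
    · simp [hi]
    · simp [hi, (isObservable_bellFactor_one hd hm hA α hi).star_mul_self]
  · rw [restTerm, tensor_pow, ← tensor_one]
    congr 1
    ext1 i
    by_cases hi : (i : ℕ) = 0
    · simp [hi]
    · simp [hi, (isObservable_bellFactor_one hd hm hA α hi).2]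

lemma stateNorm_tensor_bellFactor (hd : d ≠ 0) (hm : m ≠ 0) (hA : ∀ i x, IsObservable d (A i x))
    {i₀ : Fin N} (hi₀ : (i₀ : ℕ) = 0) (α : Fin (N - 1) → Fin m) (k : ℕ) :
    stateNorm ρ (tensor (bellFactor d A α k)) =
      stateNorm ρ (locHom n i₀ (firstFactor d (A i₀) k (settingIndex α 0))) := by
  rw [tensor_bellFactor hi₀, stateNorm_isometry_mul]
  rw [← star_eq_conjTranspose, star_pow,
    star_pow_mul_pow (isObservable_restTerm hd hm hA α).star_mul_self]

lemma stateNorm_locHom_phasedPow_add (hm : 2 ≤ m) (i : Fin N) (k x : ℕ) :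
    stateNorm ρ (locHom n i (phasedPow d (A i) k x) + locHom n i (phasedPow d (A i) k (x + 1))) =
      2 * Real.cos (Real.pi / (2 * m)) * stateNorm ρ (locHom n i (firstFactor d (A i) k x)) := by
  have hc := cos_pi_div_two_mul_pos hm
  have h := congrArg (fun X ↦ stateNorm ρ (locHom n i X))
    (two_mul_cos_smul_firstFactor (d := d) hm (A i) k x)
  simp only [map_smul, stateNorm_smul, norm_omegaPow, one_mul, Complex.norm_real, Real.norm_eq_abs,
    abs_of_pos (mul_pos two_pos hc), map_add] at h
  exact h.symm

lemma locHom_phasedPow_isometry (hd : d ≠ 0) (hm : m ≠ 0) (hA : ∀ i x, IsObservable d (A i x))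
    (i : Fin N) (k x : ℕ) :
    (locHom n i (phasedPow d (A i) k x))ᴴ * locHom n i (phasedPow d (A i) k x) = 1 := by
  rw [← star_eq_conjTranspose, ← map_star, ← map_mul, star_phasedPow_mul_self hd hm (hA i), map_one]

lemma locHom_phasedPow_self (hd : d ≠ 0) (hm : m ≠ 0) (i : Fin N) (k : ℕ) :
    locHom n i (phasedPow d (A i) k m) = -locHom n i (phasedPow d (A i) k 0) := by
  rw [phasedPow_self hd hm, map_neg]

lemma sum_stateNorm_firstFactor_le (hρ : IsState ρ) (hd : d ≠ 0) (hm : 2 ≤ m)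
    (hA : ∀ i x, IsObservable d (A i x)) (i : Fin N) (k : ℕ) :
    ∑ x ∈ Finset.range m, stateNorm ρ (locHom n i (firstFactor d (A i) k x)) ≤ m := by
  have h := sum_stateNorm_add_succ_le hρ (by omega)
    (locHom_phasedPow_isometry hd (by omega) hA i k) (locHom_phasedPow_self hd (by omega) i k)
  simp only [stateNorm_locHom_phasedPow_add hm, ← Finset.mul_sum] at h
  rw [mul_comm (m : ℝ)] at h
  exact le_of_mul_le_mul_left h (mul_pos two_pos (cos_pi_div_two_mul_pos hm))

lemma bellValue_eq_sum (d : ℕ) (A : ∀ i, Fin m → Matrix (n i) (n i) ℂ)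
    (ρ : Matrix (∀ i, n i) (∀ i, n i) ℂ) : bellValue d A ρ = ∑ k ∈ Finset.Icc 1 (d - 1),
      ∑ α : Fin (N - 1) → Fin m, (tensor (bellFactor d A α k) * ρ).trace.re := by
  rw [bellValue, bellOperator, Finset.sum_comm]
  simp only [Matrix.sum_mul, trace_sum, Complex.re_sum]

lemma sum_re_trace_bellTerm_le_sum_stateNorm (hρ : IsState ρ) (hN : 2 ≤ N) (hd : d ≠ 0)
    (hm : m ≠ 0) (hA : ∀ i x, IsObservable d (A i x)) {i₀ : Fin N} (hi₀ : (i₀ : ℕ) = 0) (k : ℕ) :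
    ∑ α : Fin (N - 1) → Fin m, (tensor (bellFactor d A α k) * ρ).trace.re ≤
      (m : ℝ) ^ (N - 2) *
        ∑ x ∈ Finset.range m, stateNorm ρ (locHom n i₀ (firstFactor d (A i₀) k x)) := by
  rw [← sum_settingIndex_zero hN]
  refine Finset.sum_le_sum fun α _ ↦ ?_
  rw [← stateNorm_tensor_bellFactor hd hm hA hi₀]
  exact re_trace_mul_le_stateNorm hρ _

lemma pow_sub_one_eq (hN : 2 ≤ N) (a : ℝ) : a ^ (N - 1) = a ^ (N - 2) * a := by
  rw [← pow_succ, show N - 2 + 1 = N - 1 by omega]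

lemma sum_re_trace_bellTerm_le (hρ : IsState ρ) (hN : 2 ≤ N) (hd : d ≠ 0) (hm : 2 ≤ m)
    (hA : ∀ i x, IsObservable d (A i x)) (k : ℕ) :
    ∑ α : Fin (N - 1) → Fin m, (tensor (bellFactor d A α k) * ρ).trace.re ≤
      (m : ℝ) ^ (N - 1) := by
  refine (sum_re_trace_bellTerm_le_sum_stateNorm hρ hN hd (by omega) hA
    (i₀ := ⟨0, by omega⟩) rfl k).trans ?_
  rw [pow_sub_one_eq hN]
  gcongr
  exact sum_stateNorm_firstFactor_le hρ hd hm hA _ k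

lemma sum_Icc_const (hd : 1 ≤ d) (c : ℝ) : ∑ _k ∈ Finset.Icc 1 (d - 1), c = c * (d - 1) := by
  rw [Finset.sum_const, Nat.card_Icc, nsmul_eq_mul, Nat.add_sub_cancel, Nat.cast_sub hd,
    Nat.cast_one, mul_comm]

theorem bellValue_le (hρ : IsState ρ) (hN : 2 ≤ N) (hd : 1 ≤ d) (hm : 2 ≤ m)
    (hA : ∀ i x, IsObservable d (A i x)) : bellValue d A ρ ≤ (m : ℝ) ^ (N - 1) * (d - 1) := by
  rw [bellValue_eq_sum, ← sum_Icc_const hd]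
  exact Finset.sum_le_sum fun k _ ↦ sum_re_trace_bellTerm_le hρ hN (by omega) hm hA k

end BellBound

section Optimal

universe u

variable {N m d : ℕ} {n : Fin N → Type u} [∀ i, Fintype (n i)] [∀ i, DecidableEq (n i)]
  {A : ∀ i, Fin m → Matrix (n i) (n i) ℂ} {ρ : Matrix (∀ i, n i) (∀ i, n i) ℂ}

/-- A state and observables that attain the maximal value `m ^ (N - 1) * (d - 1)` of the Bell
expression. -/
structure IsOptimal (d : ℕ) (A : ∀ i, Fin m → Matrix (n i) (n i) ℂ)
    (ρ : Matrix (∀ i, n i) (∀ i, n i) ℂ) : Prop where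
  isState : IsState ρ
  isObservable : ∀ i x, IsObservable d (A i x)
  le_bellValue : (m : ℝ) ^ (N - 1) * (d - 1) ≤ bellValue d A ρ

namespace IsOptimal

lemma sum_re_trace_bellTerm (h : IsOptimal d A ρ) (hN : 2 ≤ N) (hm : 2 ≤ m) {k : ℕ}
    (hk : k ∈ Finset.Icc 1 (d - 1)) :
    ∑ α : Fin (N - 1) → Fin m, (tensor (bellFactor d A α k) * ρ).trace.re =
      (m : ℝ) ^ (N - 1) := by
  have hd : 2 ≤ d := by rw [Finset.mem_Icc] at hk; omega
  have hle := fun k (_ : k ∈ Finset.Icc 1 (d - 1)) ↦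
    sum_re_trace_bellTerm_le h.isState hN (by omega) hm h.isObservable k
  refine (Finset.sum_eq_sum_iff_of_le hle).1 ((Finset.sum_le_sum hle).antisymm ?_) k hk
  rw [sum_Icc_const (by omega), ← bellValue_eq_sum]
  exact h.le_bellValue

lemma two_mul_cos_le_sum_stateNorm (h : IsOptimal d A ρ) (hN : 2 ≤ N) (hm : 2 ≤ m) {k : ℕ}
    (hk : k ∈ Finset.Icc 1 (d - 1)) {i₀ : Fin N} (hi₀ : (i₀ : ℕ) = 0) :
    m * (2 * Real.cos (Real.pi / (2 * m))) ≤ ∑ x ∈ Finset.range m,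
      stateNorm ρ (locHom n i₀ (phasedPow d (A i₀) k x) +
        locHom n i₀ (phasedPow d (A i₀) k (x + 1))) := by
  have hd : d ≠ 0 := by rw [Finset.mem_Icc] at hk; omega
  have hc := cos_pi_div_two_mul_pos hm
  have hsum := sum_re_trace_bellTerm_le_sum_stateNorm h.isState hN hd (by omega)
    h.isObservable hi₀ k
  rw [h.sum_re_trace_bellTerm hN hm hk, pow_sub_one_eq hN] at hsum
  simp only [stateNorm_locHom_phasedPow_add hm, ← Finset.mul_sum]
  rw [mul_comm (m : ℝ)]
  gcongr
  exact le_of_mul_le_mul_left hsum (by positivity)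

lemma stateNorm_firstFactor (h : IsOptimal d A ρ) (hN : 2 ≤ N) (hm : 2 ≤ m) {k : ℕ}
    (hk : k ∈ Finset.Icc 1 (d - 1)) {i₀ : Fin N} (hi₀ : (i₀ : ℕ) = 0) {x : ℕ} (hx : x < m) :
    stateNorm ρ (locHom n i₀ (firstFactor d (A i₀) k x)) = 1 := by
  have hd : d ≠ 0 := by rw [Finset.mem_Icc] at hk; omega
  have hnorm := stateNorm_add_succ_eq_of_max h.isState
    (locHom_phasedPow_isometry hd (by omega) h.isObservable i₀ k)
    (locHom_phasedPow_self hd (by omega) i₀ k) (h.two_mul_cos_le_sum_stateNorm hN hm hk hi₀) hx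
  rw [stateNorm_locHom_phasedPow_add hm] at hnorm
  exact mul_eq_left₀ (mul_pos two_pos (cos_pi_div_two_mul_pos hm)).ne' |>.1 hnorm

lemma tensor_bellFactor_mul (h : IsOptimal d A ρ) (hN : 2 ≤ N) (hm : 2 ≤ m)
    (α : Fin (N - 1) → Fin m) {k : ℕ} (hk : k ∈ Finset.Icc 1 (d - 1)) :
    tensor (bellFactor d A α k) * ρ = ρ := by
  have hd : d ≠ 0 := by rw [Finset.mem_Icc] at hk; omega
  have hnorm : ∀ α : Fin (N - 1) → Fin m, stateNorm ρ (tensor (bellFactor d A α k)) = 1 := by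
    intro α
    rw [stateNorm_tensor_bellFactor hd (by omega) h.isObservable (i₀ := ⟨0, by omega⟩) rfl,
      settingIndex_zero hN, h.stateNorm_firstFactor hN hm hk rfl (Fin.isLt _)]
  refine mul_eq_self_of_one_le_re_trace_mul h.isState (hnorm α) (ge_of_eq ?_)
  have hle := fun α (_ : α ∈ Finset.univ) ↦
    (re_trace_mul_le_stateNorm h.isState (tensor (bellFactor d A α k))).trans_eq (hnorm α)
  refine (Finset.sum_eq_sum_iff_of_le hle).1 ?_ α (Finset.mem_univ α)
  simp [h.sum_re_trace_bellTerm hN hm hk]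

lemma phasedPow_add_two (h : IsOptimal d A ρ) (hN : 2 ≤ N) (hd : 2 ≤ d) (hm : 2 ≤ m)
    {i₀ : Fin N} (hi₀ : (i₀ : ℕ) = 0) (hrank : (reducedState ρ i₀).rank = Fintype.card (n i₀))
    {x : ℕ} (hx : x + 2 ≤ m) :
    phasedPow d (A i₀) 1 (x + 2) = ((2 * Real.cos (Real.pi / m) : ℝ) : ℂ) •
      phasedPow d (A i₀) 1 (x + 1) - phasedPow d (A i₀) 1 x := by
  refine eq_of_locHom_mul_eq hrank ?_
  rw [map_sub, map_smul]
  exact add_two_mul_eq_of_max h.isState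
    (locHom_phasedPow_isometry (by omega) (by omega) h.isObservable i₀ 1)
    (locHom_phasedPow_self (by omega) (by omega) i₀ 1)
    (h.two_mul_cos_le_sum_stateNorm hN hm (Finset.mem_Icc.2 ⟨le_rfl, by omega⟩) hi₀) hx

end IsOptimal

lemma pow_mul_locHom_pow_mul {T : Matrix (∀ i, n i) (∀ i, n i) ℂ} {i : Fin N}
    {X : Matrix (n i) (n i) ℂ} (hcomm : Commute T (locHom n i X))
    (h : T * locHom n i X * ρ = ρ) (k : ℕ) : T ^ k * locHom n i (X ^ k) * ρ = ρ := by
  rw [map_pow, ← hcomm.mul_pow]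
  induction k with
  | zero => simp
  | succ k ih => rw [pow_succ, Matrix.mul_assoc, h, ih]

lemma eq_of_isometry_mul_locHom_mul_eq {i : Fin N}
    (hrank : (reducedState ρ i).rank = Fintype.card (n i))
    {T : Matrix (∀ i, n i) (∀ i, n i) ℂ} (hT : star T * T = 1) {X Y : Matrix (n i) (n i) ℂ}
    (h : T * locHom n i X * ρ = T * locHom n i Y * ρ) : X = Y := by
  refine eq_of_locHom_mul_eq hrank ?_
  have h' := congrArg (star T * ·) h
  simpa only [← Matrix.mul_assoc, hT, Matrix.one_mul] using h'

namespace IsOptimal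

/-- Up to a unitary of the other parties, `firstFactor k x` and `firstFactor 1 x ^ k` both
stabilise the state. -/
lemma firstFactor_eq_pow (h : IsOptimal d A ρ) (hN : 2 ≤ N) (hm : 2 ≤ m) {i₀ : Fin N}
    (hi₀ : (i₀ : ℕ) = 0) (hrank : (reducedState ρ i₀).rank = Fintype.card (n i₀)) {k x : ℕ}
    (hk : 1 ≤ k) (hkd : k < d) (hx : x < m) :
    firstFactor d (A i₀) k x = firstFactor d (A i₀) 1 x ^ k := by
  have hα : settingIndex (fun _ : Fin (N - 1) ↦ (⟨x, hx⟩ : Fin m)) 0 = x := settingIndex_zero hN _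
  have hfix := fun k hk ↦ h.tensor_bellFactor_mul hN hm
    (fun _ ↦ (⟨x, hx⟩ : Fin m)) (k := k) hk
  simp only [tensor_bellFactor hi₀, hα] at hfix
  have hT := (isObservable_restTerm (N := N) (by omega) (by omega) h.isObservable
    fun _ ↦ (⟨x, hx⟩ : Fin m)).star_mul_self
  refine eq_of_isometry_mul_locHom_mul_eq hrank (T := restTerm d A (fun _ ↦ ⟨x, hx⟩) ^ k)
    (by rw [star_pow, star_pow_mul_pow hT]) ?_
  rw [hfix k (Finset.mem_Icc.2 ⟨hk, by omega⟩), pow_mul_locHom_pow_mul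
    (restTerm_commute_locHom hi₀ _ _) (by simpa using hfix 1 (Finset.mem_Icc.2 ⟨le_rfl, by omega⟩))]

lemma firstFactor_pow_dim (h : IsOptimal d A ρ) (hN : 2 ≤ N) (hd : 2 ≤ d) (hm : 2 ≤ m)
    {i₀ : Fin N} (hi₀ : (i₀ : ℕ) = 0) (hrank : (reducedState ρ i₀).rank = Fintype.card (n i₀))
    {x : ℕ} (hx : x < m) : firstFactor d (A i₀) 1 x ^ d = 1 := by
  set α : Fin (N - 1) → Fin m := fun _ ↦ ⟨x, hx⟩
  have hα : settingIndex α 0 = x := settingIndex_zero hN _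
  have hfix := h.tensor_bellFactor_mul hN hm α (Finset.mem_Icc.2 ⟨le_rfl, by omega⟩)
  rw [tensor_bellFactor hi₀, hα, pow_one] at hfix
  have hpow := pow_mul_locHom_pow_mul (restTerm_commute_locHom hi₀ α _) hfix d
  rw [(isObservable_restTerm (by omega) (by omega) h.isObservable α).2, Matrix.one_mul] at hpow
  exact eq_of_locHom_mul_eq hrank (by rw [hpow, map_one, Matrix.one_mul])

lemma isObservable_firstFactor (h : IsOptimal d A ρ) (hN : 2 ≤ N) (hd : 2 ≤ d) (hm : 2 ≤ m)
    {i₀ : Fin N} (hi₀ : (i₀ : ℕ) = 0) (hrank : (reducedState ρ i₀).rank = Fintype.card (n i₀))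
    {x : ℕ} (hx : x < m) : IsObservable d (firstFactor d (A i₀) 1 x) := by
  have hpow := h.firstFactor_pow_dim hN hd hm hi₀ hrank hx
  refine ⟨mem_unitaryGroup_iff'.2 ?_, hpow⟩
  rw [star_firstFactor_one (by omega) (by omega) (h.isObservable i₀),
    h.firstFactor_eq_pow hN hm hi₀ hrank (by omega) (by omega) hx, pow_sub_one_mul (by omega),
    hpow]

end IsOptimal

lemma omegaPow_smul_twist_add_two {R : Type*} [Ring R] [Algebra ℂ R] (hd : d ≠ 0) (r s : ℝ) (P : R)
    (x : ℕ) :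
    omegaPow d (-((1 - d / 2) * ((x + 2 : ℕ) * s))) • twist d ((x + 2 : ℕ) * s + r) P =
      ((2 * Real.cos (Real.pi * s) : ℝ) : ℂ) •
        (omegaPow d (-((1 - d / 2) * ((x + 1 : ℕ) * s))) • twist d ((x + 1 : ℕ) * s + r) P) -
      omegaPow d (-((1 - d / 2) * (x * s))) • twist d (x * s + r) P := by
  have h := congrArg (omegaPow d (-((1 - d / 2) * ((x + 1 : ℕ) * s))) • ·)
    (smul_twist_add_smul_twist d ((x + 1 : ℕ) * s + r) s P)
  rw [smul_add, smul_smul, smul_smul, ← omegaPow_add, ← omegaPow_add,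
    omegaPow_half_dim_mul_add_neg hd] at h
  rw [smul_comm (((2 * Real.cos (Real.pi * s) : ℝ) : ℂ)), ← h, eq_sub_iff_add_eq, add_comm]
  congr 3 <;> (push_cast; ring)

namespace IsOptimal

lemma extObs_eq_mul_twist (h : IsOptimal d A ρ) (hN : 2 ≤ N) (hd : 2 ≤ d) (hm : 2 ≤ m)
    {i₀ : Fin N} (hi₀ : (i₀ : ℕ) = 0) (hrank : (reducedState ρ i₀).rank = Fintype.card (n i₀))
    {C P : Matrix (n i₀) (n i₀) ℂ} (hzero : extObs d (A i₀) 0 = C * twist d (-(1 / (2 * m))) P)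
    (hone : extObs d (A i₀) 1 = C * twist d (1 / (2 * m)) P) {x : ℕ} (hx : x ≤ m) :
    extObs d (A i₀) x = C * twist d (x * (1 / m) + -(1 / (2 * m))) P := by
  suffices hphase : ∀ x ≤ m, phasedPow d (A i₀) 1 x = C *
      (omegaPow d (-((1 - d / 2) * (x * (1 / m)))) • twist d (x * (1 / m) + -(1 / (2 * m))) P) by
    have hx' := hphase x hx
    rw [phasedPow, mul_smul_comm, pow_one, Nat.cast_one, mul_one_div] at hx'
    rw [mul_one_div]
    exact smul_right_injective _ (omegaPow_ne_zero _ _) hx'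
  intro x
  induction x using Nat.twoStepInduction with
  | zero => simp [phasedPow, hzero, omegaPow_zero]
  | one =>
    intro _
    have hexp : (1 : ℕ) * (1 / m : ℝ) + -(1 / (2 * m)) = 1 / (2 * m) := by
      push_cast
      field_simp
      ring
    rw [phasedPow, hexp, pow_one, hone, mul_smul_comm, mul_one_div, Nat.cast_one]
  | more x ih0 ih1 =>
    intro hx
    rw [h.phasedPow_add_two hN hd hm hi₀ hrank hx, ih0 (by omega), ih1 (by omega),
      omegaPow_smul_twist_add_two (by omega), mul_one_div Real.pi]
    simp only [mul_sub, mul_smul_comm]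

theorem exists_isShift_firstParty (h : IsOptimal d A ρ) (hN : 2 ≤ N) (hd : 2 ≤ d) (hm : 2 ≤ m)
    {i₀ : Fin N} (hi₀ : (i₀ : ℕ) = 0) (hrank : (reducedState ρ i₀).rank = Fintype.card (n i₀)) :
    ∃ P : Matrix (n i₀) (n i₀) ℂ, IsShift d (firstFactor d (A i₀) 1 0) P ∧
      (∀ x < m, firstFactor d (A i₀) 1 x = firstFactor d (A i₀) 1 0 * twist d (x / m) P) ∧
      ∀ x ≤ m, extObs d (A i₀) x =
        firstFactor d (A i₀) 1 0 * twist d (x / m - 1 / (2 * m)) P := by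
  have hC := h.isObservable_firstFactor hN hd hm hi₀ hrank (x := 0) (by omega)
  have hobs := isObservable_extObs (by omega) (by omega) (h.isObservable i₀)
  obtain ⟨P, hP, hzero, hone⟩ := exists_isShift_of_aCoeff (by omega) hm (hobs 0).star_mul_self
    (hobs 1).star_mul_self (hobs 0).2 (hobs 1).2 hC.star_mul_self hC.mul_star_self hC.2
    fun k hk hkd ↦ by rw [← h.firstFactor_eq_pow hN hm hi₀ hrank hk hkd (by omega), firstFactor]
  have hext : ∀ x ≤ m, extObs d (A i₀) x =
      firstFactor d (A i₀) 1 0 * twist d (x / m - 1 / (2 * m)) P := by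
    intro x hx
    rw [h.extObs_eq_mul_twist hN hd hm hi₀ hrank hzero hone hx, mul_one_div, sub_eq_add_neg]
  refine ⟨P, hP, fun x hx ↦ ?_, hext⟩
  rw [firstFactor, pow_one, pow_one, hext x hx.le, hext (x + 1) hx, ← mul_smul_comm,
    ← mul_smul_comm, ← mul_add, ← aCoeff_smul_twist_add (by omega) hm (x / m) P]
  congr 4
  push_cast
  field_simp
  ring

end IsOptimal

end Optimal

/-! ### Transfer of the shift structure between the parties -/

section Mirrors

universe u

variable {N : ℕ} {n : Fin N → Type u} [∀ i, Fintype (n i)] [∀ i, DecidableEq (n i)]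
  {ρ : Matrix (∀ i, n i) (∀ i, n i) ℂ} {i j k : Fin N}

/-- The operator `X` of party `i` acts on the state `ρ` as the operator `Y` of party `j`. -/
def Mirrors (ρ : Matrix (∀ i, n i) (∀ i, n i) ℂ) (X : Matrix (n i) (n i) ℂ)
    (Y : Matrix (n j) (n j) ℂ) : Prop :=
  locHom n i X * ρ = locHom n j Y * ρ

namespace Mirrors

variable {X X' : Matrix (n i) (n i) ℂ} {Y Y' : Matrix (n j) (n j) ℂ}

lemma trans {Z : Matrix (n k) (n k) ℂ} (h : Mirrors ρ X Y) (h' : Mirrors ρ Y Z) :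
    Mirrors ρ X Z :=
  Eq.trans h h'

lemma symm (h : Mirrors ρ X Y) : Mirrors ρ Y X := Eq.symm h

lemma eq (hrank : (reducedState ρ i).rank = Fintype.card (n i)) (h : Mirrors ρ X X') : X = X' :=
  eq_of_locHom_mul_eq hrank h

protected lemma one (ρ : Matrix (∀ i, n i) (∀ i, n i) ℂ) (i j : Fin N) :
    Mirrors ρ (1 : Matrix (n i) (n i) ℂ) (1 : Matrix (n j) (n j) ℂ) := by
  rw [Mirrors, map_one, map_one]

lemma smul (c : ℂ) (h : Mirrors ρ X Y) : Mirrors ρ (c • X) (c • Y) := by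
  rw [Mirrors, map_smul, map_smul, Matrix.smul_mul, Matrix.smul_mul, h]

lemma add (h : Mirrors ρ X Y) (h' : Mirrors ρ X' Y') : Mirrors ρ (X + X') (Y + Y') := by
  rw [Mirrors, map_add, map_add, Matrix.add_mul, Matrix.add_mul, h, h']

lemma sub (h : Mirrors ρ X Y) (h' : Mirrors ρ X' Y') : Mirrors ρ (X - X') (Y - Y') := by
  rw [Mirrors, map_sub, map_sub, Matrix.sub_mul, Matrix.sub_mul, h, h']

lemma sum {ι : Type*} {s : Finset ι} {X : ι → Matrix (n i) (n i) ℂ} {Y : ι → Matrix (n j) (n j) ℂ}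
    (h : ∀ a, Mirrors ρ (X a) (Y a)) : Mirrors ρ (∑ a ∈ s, X a) (∑ a ∈ s, Y a) := by
  rw [Mirrors, map_sum, map_sum, Matrix.sum_mul, Matrix.sum_mul]
  exact Finset.sum_congr rfl fun a _ ↦ h a

lemma twist (d : ℕ) (r : ℝ) (h : Mirrors ρ X Y) :
    Mirrors ρ (ASTA.twist d r X) (ASTA.twist d r Y) :=
  (((Mirrors.one ρ i j).sub h).smul _).add (h.smul _)

lemma mul (hij : i ≠ j) (h : Mirrors ρ X Y) (h' : Mirrors ρ X' Y') :
    Mirrors ρ (X * X') (Y' * Y) := by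
  rw [Mirrors, map_mul, map_mul, Matrix.mul_assoc, h', ← Matrix.mul_assoc,
    (locHom_commute hij ..).eq, Matrix.mul_assoc, h, Matrix.mul_assoc]

lemma of_mul_mul_eq (hY : Y' * Y = 1)
    (h : locHom n j Y * locHom n i X * ρ = ρ) : Mirrors ρ X Y' := by
  have h' := congrArg (locHom n j Y' * ·) h
  simpa only [Mirrors, ← Matrix.mul_assoc, ← map_mul, hY, map_one, Matrix.one_mul] using h'

lemma of_mul_eq_one (hij : i ≠ j) (hX : X' * X = 1) (hY : Y' * Y = 1) (h : Mirrors ρ X Y) :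
    Mirrors ρ X' Y' := by
  refine of_mul_mul_eq hY ?_
  rw [(locHom_commute hij.symm ..).eq, Matrix.mul_assoc, ← h, ← Matrix.mul_assoc, ← map_mul, hX,
    map_one, Matrix.one_mul]

end Mirrors

variable {G : ∀ i, Matrix (n i) (n i) ℂ}

lemma star_tensor_mul_tensor (hG : ∀ i, star (G i) * G i = 1) (hij : i ≠ j)
    {M : ∀ i, Matrix (n i) (n i) ℂ} (hM : ∀ k, k ≠ i → k ≠ j → M k = G k) :
    star (tensor G) * tensor M = locHom n i (star (G i) * M i) * locHom n j (star (G j) * M j) := by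
  rw [star_eq_conjTranspose, conjTranspose_tensor, tensor_mul, locHom_mul_locHom hij]
  congr 1
  ext1 k
  by_cases hkj : k = j
  · subst hkj
    simp
  · by_cases hki : k = i
    · subst hki
      simp [hkj]
    · simp [hkj, hki, hM k hki hkj, hG]

lemma star_tensor_mul_self (hG : ∀ i, star (G i) * G i = 1) :
    star (tensor G) * tensor G = 1 := by
  rw [star_eq_conjTranspose, conjTranspose_tensor, tensor_mul, ← tensor_one]
  exact congrArg tensor (funext hG)

lemma locHom_shiftProj (hG : ∀ i, star (G i) * G i = 1) (i : Fin N) (P : Matrix (n i) (n i) ℂ)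
    (j : ℕ) : locHom n i (shiftProj (G i) P j) = shiftProj (tensor G) (locHom n i P) j := by
  rw [shiftProj, shiftProj, star_eq_conjTranspose (tensor G), conjTranspose_tensor, tensor_pow,
    tensor_pow, locHom_apply, locHom_apply, tensor_mul, tensor_mul]
  congr 1
  ext1 k
  by_cases hk : k = i
  · subst hk
    simp
  · simp [hk, star_pow_mul_pow (hG k)]

lemma Mirrors.shiftProj (hG : ∀ i, star (G i) * G i = 1) (hGρ : tensor G * ρ = ρ)
    {P : Matrix (n i) (n i) ℂ} {Q : Matrix (n j) (n j) ℂ} (h : Mirrors ρ P Q) (k : ℕ) :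
    Mirrors ρ (shiftProj (G i) P k) (shiftProj (G j) Q k) := by
  have hpow : tensor G ^ k * ρ = ρ := by
    induction k with
    | zero => simp
    | succ k ih => rw [pow_succ, Matrix.mul_assoc, hGρ, ih]
  rw [Mirrors, locHom_shiftProj hG, locHom_shiftProj hG, ASTA.shiftProj, ASTA.shiftProj,
    Matrix.mul_assoc, hpow, Matrix.mul_assoc, h, Matrix.mul_assoc (_ * _), hpow, Matrix.mul_assoc]

lemma IsShift.of_mirrors {d : ℕ} (hij : i ≠ j)
    (hrank : (reducedState ρ i).rank = Fintype.card (n i)) (hG : ∀ i, star (G i) * G i = 1)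
    (hGρ : tensor G * ρ = ρ) (hGd : G i ^ d = 1) {P : Matrix (n i) (n i) ℂ}
    {Q : Matrix (n j) (n j) ℂ} (hQ : IsShift d (G j) Q) (hPQ : Mirrors ρ P Q)
    (hPQ' : Mirrors ρ (star P) Q) : IsShift d (G i) P := by
  have hmirror := hPQ.shiftProj hG hGρ
  refine ⟨hG i, mul_eq_one_comm.1 (hG i), hGd, ⟨?_, (hPQ'.trans hPQ.symm).eq hrank⟩, ?_, ?_⟩
  · have hsq := hPQ.mul hij hPQ
    rw [hQ.proj.isIdempotentElem.eq] at hsq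
    exact (hsq.trans hPQ.symm).eq hrank
  · intro k hk l hl hkl
    have hzero := (hmirror k).mul hij (hmirror l)
    rw [hQ.orthogonal l hl k hk hkl.symm] at hzero
    exact Mirrors.eq hrank (by rw [Mirrors, hzero, map_zero, map_zero])
  · have hone := Mirrors.sum (s := Finset.range d) hmirror
    rw [hQ.sum_eq_one] at hone
    exact (hone.trans (Mirrors.one ρ j i)).eq hrank

/-- The projection `P` is recovered from the twist `T`, which determines it as soon as the two
eigenvalues `ω ^ r` and `ω ^ (r - d r)` of `twist d r Q` differ. -/
lemma exists_isShift_of_mirrors_twist {d : ℕ} (hij : i ≠ j)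
    (hrank : (reducedState ρ i).rank = Fintype.card (n i)) (hG : ∀ i, star (G i) * G i = 1)
    (hGρ : tensor G * ρ = ρ) (hGd : G i ^ d = 1) {Q : Matrix (n j) (n j) ℂ}
    (hQ : IsShift d (G j) Q) {r : ℝ} (hr : omegaPow d (-(d * r)) ≠ 1) {T : Matrix (n i) (n i) ℂ}
    (hT : star T * T = 1) (hTQ : Mirrors ρ T (twist d r Q)) :
    ∃ P : Matrix (n i) (n i) ℂ, IsShift d (G i) P ∧ Mirrors ρ P Q := by
  set c : ℂ := omegaPow d (r - d * r) - omegaPow d r with hc_def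
  have hc : c ≠ 0 := by
    rw [hc_def, sub_eq_add_neg r, omegaPow_add, ← mul_sub_one]
    exact mul_ne_zero (omegaPow_ne_zero _ _) (sub_ne_zero.2 hr)
  have hQ_eq : Q = c⁻¹ • (twist d r Q - omegaPow d r • 1) := by
    rw [eq_inv_smul_iff₀ hc, twist, hc_def]
    module
  have hQ_star : Q = star (c⁻¹) • (star (twist d r Q) - star (omegaPow d r) • 1) := by
    have hstar := congrArg star hQ_eq
    rwa [hQ.proj.isSelfAdjoint.star_eq, star_smul, star_sub, star_smul, star_one] at hstar
  have hT_star : Mirrors ρ (star T) (star (twist d r Q)) := by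
    refine hTQ.of_mul_eq_one hij hT ?_
    rw [star_twist d r hQ.proj.isSelfAdjoint]
    exact mul_eq_one_comm.1 (twist_mul_neg d r hQ.proj.isIdempotentElem)
  have hP : Mirrors ρ (c⁻¹ • (T - omegaPow d r • 1)) Q := by
    have h := (hTQ.sub ((Mirrors.one ρ i j).smul (omegaPow d r))).smul c⁻¹
    rwa [← hQ_eq] at h
  have hP_star : Mirrors ρ (star (c⁻¹ • (T - omegaPow d r • 1))) Q := by
    have h := (hT_star.sub ((Mirrors.one ρ i j).smul (star (omegaPow d r)))).smul (star c⁻¹)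
    rwa [← hQ_star, ← star_one, ← star_smul, ← star_sub, ← star_smul] at h
  exact ⟨_, hQ.of_mirrors hij hrank hG hGρ hGd hP hP_star, hP⟩

end Mirrors

section Transfer

universe u

variable {N m d : ℕ} {n : Fin N → Type u} [∀ i, Fintype (n i)] [∀ i, DecidableEq (n i)]
  {A : ∀ i, Fin m → Matrix (n i) (n i) ℂ} {ρ : Matrix (∀ i, n i) (∀ i, n i) ℂ}

/-- The sign `(-1)^i` of the exponent with which the observables of party `i` enter the Bell terms:
`X` if it is positive and `X† = X⁻¹` if it is negative. -/
def oriented {R : Type*} [Star R] (i : ℕ) (X : R) : R := if Even i then X else star X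

/-- The factor of party `i` with setting `q` in the Bell terms with `k = 1`. -/
noncomputable def partyFactor (d : ℕ) (A : ∀ i, Fin m → Matrix (n i) (n i) ℂ) (i : Fin N)
    (q : ℕ) : Matrix (n i) (n i) ℂ :=
  if (i : ℕ) = 0 then firstFactor d (A i) 1 q else oriented i (extObs d (A i) q)

lemma bellFactor_one_eq (α : Fin (N - 1) → Fin m) (i : Fin N) : bellFactor d A α 1 i =
    partyFactor d A i (if (i : ℕ) = 0 then settingIndex α 0
      else settingIndex α (i - 1) + settingIndex α i) := by
  rw [partyFactor]
  by_cases hi : (i : ℕ) = 0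
  · rw [bellFactor_zero hi, if_pos hi, if_pos hi]
  · rw [bellFactor, if_neg hi, if_neg hi, if_neg hi, pow_one, pow_one, oriented,
      star_eq_conjTranspose]

/-- The setting `x` on the link between the parties `i - 1` and `i`, and `0` on the others. -/
def linkSetting {x : ℕ} (i : ℕ) (hx : x < m) : Fin (N - 1) → Fin m :=
  fun j ↦ if (j : ℕ) + 1 = i then ⟨x, hx⟩ else ⟨0, by omega⟩

lemma settingIndex_linkSetting {i x : ℕ} (hx : x < m) (hi : i < N) (j : ℕ) :
    settingIndex (linkSetting (N := N) i hx) j = if j + 1 = i then x else 0 := by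
  rw [settingIndex]
  split_ifs with hj hji
  · simp [linkSetting, hji]
  · simp [linkSetting, hji]
  · omega
  · rfl

lemma bellFactor_linkSetting {i x : ℕ} (hx : x < m) (hi : i < N) (hi0 : i ≠ 0) :
    bellFactor d A (linkSetting i hx) 1 = fun j : Fin N ↦
      partyFactor d A j (if (j : ℕ) + 1 = i ∨ (j : ℕ) = i then x else 0) := by
  ext1 j
  rw [bellFactor_one_eq]
  simp only [settingIndex_linkSetting hx hi]
  congr 1
  split_ifs <;> omega

namespace IsOptimal

lemma isObservable_partyFactor (h : IsOptimal d A ρ) (hN : 2 ≤ N) (hd : 2 ≤ d) (hm : 2 ≤ m)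
    (hrank : ∀ i, (reducedState ρ i).rank = Fintype.card (n i)) (i : Fin N) {q : ℕ} (hq : q < m) :
    IsObservable d (partyFactor d A i q) := by
  have hext := isObservable_extObs (by omega) (by omega) (h.isObservable i) q
  rw [partyFactor, oriented]
  split_ifs with hi
  · exact h.isObservable_firstFactor hN hd hm hi (hrank i) hq
  · exact hext
  · exact hext.star

lemma tensor_partyFactor_mul (h : IsOptimal d A ρ) (hN : 2 ≤ N) (hd : 2 ≤ d) (hm : 2 ≤ m)
    {i x : ℕ} (hx : x < m) (hi : i < N) (hi0 : i ≠ 0) :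
    tensor (fun j ↦ partyFactor d A j (if (j : ℕ) + 1 = i ∨ (j : ℕ) = i then x else 0)) * ρ =
      ρ := by
  rw [← bellFactor_linkSetting hx hi hi0]
  exact h.tensor_bellFactor_mul hN hm _ (Finset.mem_Icc.2 ⟨le_rfl, by omega⟩)

lemma tensor_partyFactor_zero_mul (h : IsOptimal d A ρ) (hN : 2 ≤ N) (hd : 2 ≤ d) (hm : 2 ≤ m) :
    tensor (fun i ↦ partyFactor d A i 0) * ρ = ρ := by
  simpa only [ite_self] using
    h.tensor_partyFactor_mul hN hd hm (i := 1) (x := 0) (by omega) (by omega) one_ne_zero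

lemma locHom_mul_locHom_succ_mul (h : IsOptimal d A ρ) (hN : 2 ≤ N) (hd : 2 ≤ d) (hm : 2 ≤ m)
    (hrank : ∀ i, (reducedState ρ i).rank = Fintype.card (n i)) {i j : Fin N}
    (hij : (j : ℕ) = i + 1) {x : ℕ} (hx : x < m) :
    locHom n i (star (partyFactor d A i 0) * partyFactor d A i x) *
      locHom n j (star (partyFactor d A j 0) * partyFactor d A j x) * ρ = ρ := by
  have hG := fun i ↦ (h.isObservable_partyFactor hN hd hm hrank i (q := 0)
    (by omega)).star_mul_self
  have hne : i ≠ j := by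
    rintro rfl
    omega
  have hfix := star_tensor_mul_tensor hG hne (M := fun k ↦ partyFactor d A k
    (if (k : ℕ) + 1 = j ∨ (k : ℕ) = j then x else 0)) fun k hki hkj ↦ by
      have := Fin.val_ne_of_ne hki
      have := Fin.val_ne_of_ne hkj
      rw [if_neg (by omega)]
  simp only [hij, true_or, or_true, if_true] at hfix
  rw [← hfix, ← hij, Matrix.mul_assoc, h.tensor_partyFactor_mul hN hd hm hx j.isLt (by omega)]
  nth_rw 1 [← h.tensor_partyFactor_zero_mul hN hd hm]
  rw [← Matrix.mul_assoc, star_tensor_mul_self hG, Matrix.one_mul]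

end IsOptimal

lemma omegaPow_neg_dim_mul_ne_one (hd : d ≠ 0) (hm : 2 ≤ m) (k : ℕ) :
    omegaPow d (-(d * ((-1) ^ k * (1 / m)))) ≠ 1 := by
  have hpos := omegaPow_dim_mul_ne_one hd (r := 1 / m) (by positivity)
    ((div_lt_one (by positivity)).2 (by exact_mod_cast hm))
  rcases neg_one_pow_eq_or ℝ k with hk | hk
  · rw [hk, one_mul]
    intro hone
    have hinv := omegaPow_mul_neg d (d * (1 / m : ℝ))
    rw [hone, mul_one] at hinv
    exact hpos hinv
  · rwa [hk, neg_one_mul, mul_neg, neg_neg]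

namespace IsOptimal

lemma exists_isShift_succ (h : IsOptimal d A ρ) (hN : 2 ≤ N) (hd : 2 ≤ d) (hm : 2 ≤ m)
    (hrank : ∀ i, (reducedState ρ i).rank = Fintype.card (n i)) {i j : Fin N}
    (hij : (j : ℕ) = i + 1) {P : Matrix (n i) (n i) ℂ} (hP : IsShift d (partyFactor d A i 0) P)
    (hx : ∀ x < m, partyFactor d A i x =
      partyFactor d A i 0 * twist d ((-1) ^ (i : ℕ) * (x / m)) P) :
    ∃ Q : Matrix (n j) (n j) ℂ, IsShift d (partyFactor d A j 0) Q ∧ Mirrors ρ Q P ∧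
      ∀ x < m, partyFactor d A j x =
        partyFactor d A j 0 * twist d ((-1) ^ (j : ℕ) * (x / m)) Q := by
  have hne : j ≠ i := by
    rintro rfl
    omega
  have hG := fun i ↦ h.isObservable_partyFactor hN hd hm hrank i (q := 0) (by omega)
  have hT : ∀ x < m, Mirrors ρ (star (partyFactor d A j 0) * partyFactor d A j x)
      (twist d ((-1) ^ (j : ℕ) * (x / m)) P) := by
    intro x hxm
    have hlink := h.locHom_mul_locHom_succ_mul hN hd hm hrank hij hxm
    rw [hx x hxm, ← mul_assoc, (hG i).star_mul_self, one_mul] at hlink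
    refine Mirrors.of_mul_mul_eq ?_ hlink
    rw [hij, pow_succ, mul_neg_one, neg_mul]
    exact mul_eq_one_comm.1 (twist_mul_neg d _ hP.proj.isIdempotentElem)
  have hT_one : star (star (partyFactor d A j 0) * partyFactor d A j 1) *
      (star (partyFactor d A j 0) * partyFactor d A j 1) = 1 := by
    rw [star_mul, star_star, mul_assoc, ← mul_assoc (partyFactor d A j 0), (hG j).mul_star_self,
      one_mul, (h.isObservable_partyFactor hN hd hm hrank j hm).star_mul_self]
  have hT₁ := hT 1 hm
  rw [Nat.cast_one] at hT₁
  obtain ⟨Q, hQ, hQP⟩ := exists_isShift_of_mirrors_twist hne (hrank j)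
    (fun i ↦ (hG i).star_mul_self) (h.tensor_partyFactor_zero_mul hN hd hm) (hG j).2 hP
    (omegaPow_neg_dim_mul_ne_one (by omega) hm j) hT_one hT₁
  refine ⟨Q, hQ, hQP, fun x hxm ↦ ?_⟩
  rw [← ((hT x hxm).trans (hQP.twist d _).symm).eq (hrank j), ← mul_assoc, (hG j).mul_star_self,
    one_mul]

lemma exists_isShift_partyFactor (h : IsOptimal d A ρ) (hN : 2 ≤ N) (hd : 2 ≤ d) (hm : 2 ≤ m)
    (hrank : ∀ i, (reducedState ρ i).rank = Fintype.card (n i)) {i₀ : Fin N} (hi₀ : (i₀ : ℕ) = 0)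
    {P₀ : Matrix (n i₀) (n i₀) ℂ} (hP₀ : IsShift d (partyFactor d A i₀ 0) P₀)
    (hx : ∀ x < m, partyFactor d A i₀ x = partyFactor d A i₀ 0 * twist d (x / m) P₀) (i : Fin N) :
    ∃ P : Matrix (n i) (n i) ℂ, IsShift d (partyFactor d A i 0) P ∧ Mirrors ρ P P₀ ∧
      ∀ x < m, partyFactor d A i x =
        partyFactor d A i 0 * twist d ((-1) ^ (i : ℕ) * (x / m)) P := by
  obtain ⟨k, hk⟩ := i
  induction k with
  | zero =>
    obtain rfl : i₀ = ⟨0, hk⟩ := Fin.ext hi₀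
    exact ⟨P₀, hP₀, rfl, by simpa using hx⟩
  | succ k ih =>
    obtain ⟨P, hP, hPP₀, hPx⟩ := ih (by omega)
    obtain ⟨Q, hQ, hQP, hQx⟩ := h.exists_isShift_succ hN hd hm hrank (j := ⟨k + 1, hk⟩) rfl hP hPx
    exact ⟨Q, hQ, hQP.trans hPP₀, hQx⟩

end IsOptimal

/-- The observables of party `i` at the maximal value are a shift twisted by this exponent. -/
noncomputable def partyPhase (m i x : ℕ) : ℝ :=
  if i = 0 then x / m - 1 / (2 * m) else (-1) ^ i * (x / m)

theorem IsOptimal.exists_isShift (h : IsOptimal d A ρ) (hN : 2 ≤ N) (hd : 2 ≤ d) (hm : 2 ≤ m)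
    (hrank : ∀ i, (reducedState ρ i).rank = Fintype.card (n i)) :
    ∃ S P : ∀ i, Matrix (n i) (n i) ℂ, (∀ i, IsShift d (S i) (P i)) ∧ tensor S * ρ = ρ ∧
      (∀ i j, Mirrors ρ (P i) (P j)) ∧
      ∀ (i : Fin N) (x : Fin m), oriented i (A i x) = S i * twist d (partyPhase m i x) (P i) := by
  have hi₀ : ((⟨0, by omega⟩ : Fin N) : ℕ) = 0 := rfl
  generalize (⟨0, by omega⟩ : Fin N) = i₀ at hi₀
  obtain ⟨P₀, hP₀, hfirst, hext⟩ := h.exists_isShift_firstParty hN hd hm hi₀ (hrank i₀)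
  have hfactor : ∀ q, partyFactor d A i₀ q = firstFactor d (A i₀) 1 q := fun q ↦ if_pos hi₀
  simp only [← hfactor] at hP₀ hfirst hext
  choose P hP hmirror hx using h.exists_isShift_partyFactor hN hd hm hrank hi₀ hP₀ hfirst
  refine ⟨fun i ↦ partyFactor d A i 0, P, hP, h.tensor_partyFactor_zero_mul hN hd hm,
    fun i j ↦ (hmirror i).trans (hmirror j).symm, fun i x ↦ ?_⟩
  rw [partyPhase]
  split_ifs with hi
  · obtain rfl : i = i₀ := Fin.ext (hi.trans hi₀.symm)
    rw [(hmirror i).eq (hrank i), ← hext x x.isLt.le, extObs_of_lt _ x.isLt, hi, oriented,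
      if_pos Even.zero]
  · rw [← hx i x x.isLt, partyFactor, if_neg hi, extObs_of_lt _ x.isLt]

end Transfer

/-! ### The GHZ state -/

lemma omegaPow_sum (d : ℕ) {ι : Type*} (s : Finset ι) (f : ι → ℝ) :
    omegaPow d (∑ i ∈ s, f i) = ∏ i ∈ s, omegaPow d (f i) := by
  simp only [omegaPow, ← Complex.exp_sum, ← Finset.sum_div, ← Finset.mul_sum, Complex.ofReal_sum]

section GHZ

variable {N d : ℕ}

lemma ghz_eq_sum (a : Fin N → Fin d) :
    ghz N d a = ((1 / Real.sqrt d : ℝ) : ℂ) * ∑ j, if a = fun _ ↦ j then 1 else 0 := by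
  simp only [ghz, Finset.prod_ite_zero, Finset.prod_const_one, funext_iff, Finset.mem_univ,
    true_imp_iff]

lemma ghz_const (i₀ : Fin N) (j : Fin d) :
    ghz N d (fun _ ↦ j) = ((1 / Real.sqrt d : ℝ) : ℂ) := by
  have hconst : ∀ k : Fin d, ((fun _ : Fin N ↦ j) = fun _ ↦ k) ↔ j = k := fun k ↦
    ⟨fun h ↦ congrFun h i₀, fun h ↦ by rw [h]⟩
  simp [ghz_eq_sum, hconst]

lemma ghz_eq_zero {a : Fin N → Fin d} (ha : ∀ j, a ≠ fun _ ↦ j) : ghz N d a = 0 := by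
  simp [ghz_eq_sum, ha]

lemma ghz_dotProduct (v : (Fin N → Fin d) → ℂ) :
    ghz N d ⬝ᵥ v = ((1 / Real.sqrt d : ℝ) : ℂ) * ∑ j, v fun _ ↦ j := by
  simp only [dotProduct, ghz_eq_sum, mul_assoc, ← Finset.mul_sum, Finset.sum_mul, ite_mul, one_mul,
    zero_mul]
  rw [Finset.sum_comm]
  simp

lemma trace_ghzState (i₀ : Fin N) (hd : d ≠ 0) : (ghzState N d).trace = 1 := by
  have hd' : (d : ℂ) ≠ 0 := by exact_mod_cast hd
  simp only [ghzState, trace_vecMulVec, ghz_dotProduct, Pi.star_apply, ghz_const i₀,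
    Complex.star_def, Complex.conj_ofReal, Finset.sum_const, Finset.card_univ, Fintype.card_fin,
    nsmul_eq_mul]
  rw [mul_left_comm, one_div_sqrt_mul_self, mul_one_div_cancel hd']

lemma isState_ghzState (i₀ : Fin N) (hd : d ≠ 0) : IsState (ghzState N d) :=
  ⟨posSemidef_vecMulVec_self_star _, trace_ghzState i₀ hd⟩

variable [NeZero d]

open Fin.NatCast Fin.CommRing in
lemma val_nsmul_one (j : Fin d) : (j : ℕ) • (1 : Fin d) = j := by
  rw [nsmul_one, Fin.cast_val_eq_self]

lemma lowerPhase_apply_succ (r : ℝ) (a : Fin d) :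
    lowerPhase d r a (a + 1) = omegaPow d ((((a + 1 : Fin d) : ℕ) - (a : ℕ) : ℝ) * r) := by
  rw [lowerPhase_apply, if_pos (by simp [Fin.val_add])]

lemma lowerPhase_apply_of_ne (r : ℝ) {a b : Fin d} (h : b ≠ a + 1) : lowerPhase d r a b = 0 := by
  rw [lowerPhase_apply, if_neg fun hb ↦ h (Fin.ext (by simp [hb, Fin.val_add]))]

lemma tensor_lowerPhase_mulVec (τ : Fin N → ℝ) (v : (Fin N → Fin d) → ℂ) (a : Fin N → Fin d) :
    (tensor (fun i ↦ lowerPhase d (τ i)) *ᵥ v) a =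
      (∏ i, lowerPhase d (τ i) (a i) (a i + 1)) * v (a + 1) := by
  rw [mulVec, dotProduct, Finset.sum_eq_single (a + 1)]
  · rfl
  · intro b _ hb
    obtain ⟨i, hi⟩ := ne_iff.1 hb
    have hzero : lowerPhase d (τ i) (a i) (b i) = 0 := lowerPhase_apply_of_ne _ hi
    rw [tensor_apply, Finset.prod_eq_zero (Finset.mem_univ i) hzero, zero_mul]
  · simp

lemma prod_lowerPhase_const {τ : Fin N → ℝ} (hτ : ∑ i, τ i = 0) (j : Fin d) :
    ∏ i, lowerPhase d (τ i) j (j + 1) = 1 := by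
  simp only [lowerPhase_apply_succ, ← omegaPow_sum, ← Finset.mul_sum, hτ, mul_zero, omegaPow_zero]

lemma tensor_lowerPhase_mulVec_ghz (i₀ : Fin N) {τ : Fin N → ℝ} (hτ : ∑ i, τ i = 0) :
    tensor (fun i ↦ lowerPhase d (τ i)) *ᵥ ghz N d = ghz N d := by
  ext a
  rw [tensor_lowerPhase_mulVec]
  by_cases ha : ∃ j, a = fun _ ↦ j
  · obtain ⟨j, rfl⟩ := ha
    have hsucc : (fun _ ↦ j : Fin N → Fin d) + 1 = fun _ ↦ j + 1 := rfl
    rw [prod_lowerPhase_const hτ, hsucc, ghz_const i₀, ghz_const i₀, one_mul]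
  · push Not at ha
    rw [ghz_eq_zero ha, ghz_eq_zero, mul_zero]
    exact fun j hj ↦ ha (j - 1) (funext fun i ↦ eq_sub_of_add_eq (congrFun hj i))

section Uniqueness

variable {τ : Fin N → ℝ} {v : (Fin N → Fin d) → ℂ}

lemma locHom_firstProj_mulVec (i : Fin N) (v : (Fin N → Fin d) → ℂ) (a : Fin N → Fin d) :
    (locHom (fun _ ↦ Fin d) i (firstProj d) *ᵥ v) a = if a i = 0 then v a else 0 := by
  have hdiag : locHom (fun _ ↦ Fin d) i (firstProj d) =
      diagonal fun x ↦ if x i = 0 then 1 else 0 := by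
    ext x y
    rw [locHom_apply, tensor_update_one_apply, firstProj, diagonal_apply, diagonal_apply]
    simp only [Fin.val_eq_zero_iff]
    by_cases hxy : x = y
    · simp [hxy]
    · rw [if_neg hxy]
      split_ifs with hy hi <;> try rfl
      exact absurd (by rw [hy, ← hi, update_eq_self]) hxy
  rw [hdiag, mulVec_diagonal, ite_mul, one_mul, zero_mul]

/-- Shifting an index in the support until one of its components vanishes makes all of them
vanish. -/
lemma eq_const_of_apply_ne_zero (hv : tensor (fun i ↦ lowerPhase d (τ i)) *ᵥ v = v)
    (hP : ∀ i j, locHom (fun _ ↦ Fin d) i (firstProj d) *ᵥ v =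
      locHom (fun _ ↦ Fin d) j (firstProj d) *ᵥ v)
    {a : Fin N → Fin d} (ha : v a ≠ 0) (i j : Fin N) : a i = a j := by
  have hshift : ∀ k : ℕ, v (a + k • 1) ≠ 0 := by
    intro k
    induction k with
    | zero => simpa using ha
    | succ k ih =>
      rw [← hv, tensor_lowerPhase_mulVec] at ih
      rw [succ_nsmul, ← add_assoc]
      exact right_ne_zero_of_mul ih
  obtain ⟨k, hk⟩ : ∃ k : ℕ, a j + k • 1 = 0 :=
    ⟨(-a j : Fin d), by rw [val_nsmul_one, add_neg_cancel]⟩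
  have hi := congrFun (hP i j) (a + k • 1)
  simp only [locHom_firstProj_mulVec, Pi.add_apply, Pi.smul_apply, Pi.one_apply, hk,
    if_true] at hi
  by_contra hij
  rw [if_neg fun h ↦ hij (add_right_cancel (h.trans hk.symm))] at hi
  exact hshift k hi.symm

lemma apply_const_eq (hτ : ∑ i, τ i = 0) (hv : tensor (fun i ↦ lowerPhase d (τ i)) *ᵥ v = v)
    (j : Fin d) : v (fun _ ↦ j) = v 0 := by
  have hshift : ∀ k : ℕ, v (fun _ ↦ k • 1) = v 0 := by
    intro k
    induction k with
    | zero => simp only [zero_smul]; rfl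
    | succ k ih =>
      rw [← ih, ← congrFun hv fun _ ↦ k • 1, tensor_lowerPhase_mulVec, prod_lowerPhase_const hτ,
        one_mul]
      simp only [succ_nsmul]
      rfl
  simpa only [val_nsmul_one] using hshift j

lemma eq_smul_ghz (i₀ : Fin N) (hτ : ∑ i, τ i = 0)
    (hv : tensor (fun i ↦ lowerPhase d (τ i)) *ᵥ v = v)
    (hP : ∀ i j, locHom (fun _ ↦ Fin d) i (firstProj d) *ᵥ v =
      locHom (fun _ ↦ Fin d) j (firstProj d) *ᵥ v) :
    v = ((Real.sqrt d : ℝ) * v 0) • ghz N d := by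
  ext a
  have hd : ((Real.sqrt d : ℝ) : ℂ) ≠ 0 := by
    simpa using NeZero.ne d
  rw [Pi.smul_apply, smul_eq_mul]
  by_cases ha : ∃ j, a = fun _ ↦ j
  · obtain ⟨j, rfl⟩ := ha
    rw [apply_const_eq hτ hv, ghz_const i₀]
    push_cast
    field_simp
  · push Not at ha
    rw [ghz_eq_zero ha, mul_zero]
    by_contra hva
    exact ha (a i₀) (funext fun i ↦ eq_const_of_apply_ne_zero hv hP hva i i₀)

variable {κ : Type*} [Fintype κ] [DecidableEq κ]

lemma kronecker_one_mul_apply {ι : Type*} [Fintype ι] (M : Matrix ι ι ℂ)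
    (R : Matrix (ι × κ) (ι × κ) ℂ) (a : ι) (s : κ) (y : ι × κ) :
    ((M ⊗ₖ (1 : Matrix κ κ ℂ)) * R) (a, s) y = (M *ᵥ fun a' ↦ R (a', s) y) a := by
  simp [Matrix.mul_apply, mulVec, dotProduct, Fintype.sum_prod_type, Matrix.one_apply]

lemma eq_ghzState_kronecker (i₀ : Fin N) (hτ : ∑ i, τ i = 0)
    {R : Matrix ((Fin N → Fin d) × κ) ((Fin N → Fin d) × κ) ℂ} (hR : R.IsHermitian)
    (hS : (tensor (fun i ↦ lowerPhase d (τ i)) ⊗ₖ (1 : Matrix κ κ ℂ)) * R = R)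
    (hP : ∀ i j, (locHom (fun _ ↦ Fin d) i (firstProj d) ⊗ₖ (1 : Matrix κ κ ℂ)) * R =
      (locHom (fun _ ↦ Fin d) j (firstProj d) ⊗ₖ (1 : Matrix κ κ ℂ)) * R) :
    R = ghzState N d ⊗ₖ ((d : ℂ) • R.submatrix (Prod.mk 0) (Prod.mk 0)) := by
  have hcol : ∀ a s y, R (a, s) y = (Real.sqrt d : ℝ) * R (0, s) y * ghz N d a := by
    intro a s y
    refine congrFun (eq_smul_ghz (v := fun a ↦ R (a, s) y) i₀ hτ ?_ fun i j ↦ ?_) a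
    · ext a
      rw [← kronecker_one_mul_apply, hS]
    · ext a
      rw [← kronecker_one_mul_apply, ← kronecker_one_mul_apply, hP i j]
  ext ⟨a, s⟩ ⟨b, t⟩
  have hsqrt : ((Real.sqrt d : ℝ) : ℂ) * (Real.sqrt d : ℝ) = d := by
    rw [← Complex.ofReal_mul, Real.mul_self_sqrt d.cast_nonneg, Complex.ofReal_natCast]
  rw [hcol, ← hR.apply (0, s), hcol b t, star_mul', star_mul', hR.apply (0, s) (0, t),
    Complex.star_def, Complex.conj_ofReal, kroneckerMap_apply, Matrix.smul_apply, submatrix_apply,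
    ghzState, vecMulVec_apply, Pi.star_apply, smul_eq_mul, ← hsqrt]
  simp only [Complex.star_def]
  ring

end Uniqueness

end GHZ

section Rigidity

universe u

variable {N d : ℕ} {n : Fin N → Type u}

/-- Separation of the ideal and the auxiliary factors of all parties. -/
def splitEquiv {D : Fin N → ℕ} (e : ∀ i, n i ≃ Fin d × Fin (D i)) :
    (∀ i, n i) ≃ (Fin N → Fin d) × (∀ i, Fin (D i)) :=
  (Equiv.piCongrRight e).trans
    { toFun := fun x ↦ (fun i ↦ (x i).1, fun i ↦ (x i).2)
      invFun := fun p i ↦ (p.1 i, p.2 i)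
      left_inv := fun _ ↦ rfl
      right_inv := fun _ ↦ rfl }

variable {D : Fin N → ℕ} (e : ∀ i, n i ≃ Fin d × Fin (D i))

lemma reindex_tensor {X : ∀ i, Matrix (n i) (n i) ℂ} {Y : Fin N → Matrix (Fin d) (Fin d) ℂ}
    (h : ∀ i, reindex (e i) (e i) (X i) = Y i ⊗ₖ (1 : Matrix (Fin (D i)) (Fin (D i)) ℂ)) :
    reindex (splitEquiv e) (splitEquiv e) (tensor X) =
      tensor Y ⊗ₖ (1 : Matrix (∀ i, Fin (D i)) (∀ i, Fin (D i)) ℂ) := by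
  ext ⟨a, s⟩ ⟨b, t⟩
  rw [← tensor_one, kroneckerMap_apply, tensor_apply, tensor_apply, ← Finset.prod_mul_distrib]
  change ∏ i, reindex (e i) (e i) (X i) (a i, s i) (b i, t i) = _
  exact Finset.prod_congr rfl fun i _ ↦ congrFun (congrFun (h i) (a i, s i)) (b i, t i)

variable [∀ i, Fintype (n i)]

lemma tensor_conj (U X : ∀ i, Matrix (n i) (n i) ℂ) :
    tensor U * tensor X * (tensor U)ᴴ = tensor fun i ↦ U i * X i * (U i)ᴴ := by
  rw [conjTranspose_tensor, tensor_mul, tensor_mul]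
  rfl

variable [∀ i, DecidableEq (n i)]

lemma reindex_locHom {i : Fin N} {X : Matrix (n i) (n i) ℂ} {Y : Matrix (Fin d) (Fin d) ℂ}
    (h : reindex (e i) (e i) X = Y ⊗ₖ (1 : Matrix (Fin (D i)) (Fin (D i)) ℂ)) :
    reindex (splitEquiv e) (splitEquiv e) (locHom n i X) =
      locHom (fun _ ↦ Fin d) i Y ⊗ₖ (1 : Matrix (∀ i, Fin (D i)) (∀ i, Fin (D i)) ℂ) := by
  rw [locHom_apply, locHom_apply]
  refine reindex_tensor e fun j ↦ ?_
  by_cases hj : j = i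
  · subst hj
    simpa using h
  · simp [update_of_ne hj]

variable {U : ∀ i, Matrix (n i) (n i) ℂ}

lemma locHom_conj (hU : ∀ i, U i * (U i)ᴴ = 1) (i : Fin N) (X : Matrix (n i) (n i) ℂ) :
    tensor U * locHom n i X * (tensor U)ᴴ = locHom n i (U i * X * (U i)ᴴ) := by
  rw [locHom_apply, locHom_apply, tensor_conj]
  congr 1
  ext1 j
  by_cases hj : j = i
  · subst hj
    simp
  · rw [update_of_ne hj, update_of_ne hj, Pi.one_apply, Matrix.mul_one, hU]

lemma conj_mul_conj {κ : Type*} [Fintype κ] [DecidableEq κ] {V : Matrix κ κ ℂ} (hV : Vᴴ * V = 1)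
    (X Y : Matrix κ κ ℂ) : V * X * Vᴴ * (V * Y * Vᴴ) = V * (X * Y) * Vᴴ := by
  simp only [Matrix.mul_assoc]
  rw [← Matrix.mul_assoc Vᴴ, hV, Matrix.one_mul]

lemma reindex_mul {κ ι : Type*} [Fintype κ] [Fintype ι] (f : κ ≃ ι) (X Y : Matrix κ κ ℂ) :
    reindex f f (X * Y) = reindex f f X * reindex f f Y :=
  (submatrix_mul_equiv X Y f.symm f.symm f.symm).symm

lemma IsState.conj {κ : Type*} [Fintype κ] [DecidableEq κ] {ρ V : Matrix κ κ ℂ} (hρ : IsState ρ)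
    (hV : Vᴴ * V = 1) : IsState (V * ρ * Vᴴ) :=
  ⟨hρ.1.mul_mul_conjTranspose_same V,
    by rw [trace_mul_comm, ← Matrix.mul_assoc, hV, Matrix.one_mul, hρ.2]⟩

lemma IsState.reindex {κ ι : Type*} [Fintype κ] [Fintype ι] {ρ : Matrix κ κ ℂ} (hρ : IsState ρ)
    (f : κ ≃ ι) : IsState (reindex f f ρ) :=
  ⟨hρ.1.submatrix f.symm, by rw [← hρ.2]; exact f.symm.sum_comp fun x ↦ ρ x x⟩

variable {ρ : Matrix (∀ i, n i) (∀ i, n i) ℂ} {S P : ∀ i, Matrix (n i) (n i) ℂ}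

theorem exists_unitary_of_isShift (i₀ : Fin N) (hd : d ≠ 0) (hρ : IsState ρ)
    (hS : ∀ i, IsShift d (S i) (P i)) (hSρ : tensor S * ρ = ρ)
    (hP : ∀ i j, Mirrors ρ (P i) (P j)) {τ : Fin N → ℝ} (hτ : ∑ i, τ i = 0) :
    ∃ (D : Fin N → ℕ) (e : ∀ i, n i ≃ Fin d × Fin (D i)) (U : ∀ i, Matrix (n i) (n i) ℂ)
      (σ : Matrix (∀ i, Fin (D i)) (∀ i, Fin (D i)) ℂ),
      (∀ i, U i ∈ unitaryGroup (n i) ℂ) ∧ IsState σ ∧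
      reindex (splitEquiv e) (splitEquiv e) (tensor U * ρ * (tensor U)ᴴ) =
        ghzState N d ⊗ₖ σ ∧
      ∀ i (r : ℝ), reindex (e i) (e i) (U i * (S i * twist d r (P i)) * (U i)ᴴ) =
        lowerPhase d (r - τ i) ⊗ₖ (1 : Matrix (Fin (D i)) (Fin (D i)) ℂ) := by
  have : NeZero d := ⟨hd⟩
  choose D e U hU hform hproj using fun i ↦ (hS i).exists_unitary (τ i)
  have hUU : (tensor U)ᴴ * tensor U = 1 :=
    star_tensor_mul_self fun i ↦ mem_unitaryGroup_iff'.1 (hU i)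
  set f := splitEquiv e
  set R := reindex f f (tensor U * ρ * (tensor U)ᴴ) with hR
  have hRstate : IsState R := (hρ.conj hUU).reindex f
  have hact : ∀ X, reindex f f (tensor U * X * (tensor U)ᴴ) * R =
      reindex f f (tensor U * (X * ρ) * (tensor U)ᴴ) := fun X ↦ by
    rw [hR, ← reindex_mul, conj_mul_conj hUU]
  have hshift : (tensor (fun i ↦ lowerPhase d (-τ i)) ⊗ₖ
      (1 : Matrix (∀ i, Fin (D i)) (∀ i, Fin (D i)) ℂ)) * R = R := by
    rw [← reindex_tensor e fun i ↦ ?_, ← tensor_conj, hact, hSρ]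
    simpa only [twist_zero, Matrix.mul_one, zero_sub] using hform i 0
  have hfirst : ∀ i, (locHom (fun _ ↦ Fin d) i (firstProj d) ⊗ₖ
      (1 : Matrix (∀ i, Fin (D i)) (∀ i, Fin (D i)) ℂ)) * R =
        reindex f f (tensor U * (locHom n i (P i) * ρ) * (tensor U)ᴴ) := fun i ↦ by
    rw [← reindex_locHom e (hproj i), ← locHom_conj fun i ↦ mem_unitaryGroup_iff.1 (hU i), hact]
  have hsplit := eq_ghzState_kronecker i₀ (by simp [hτ]) hRstate.1.1 hshift fun i j ↦ by
    rw [hfirst, hfirst, hP i j]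
  refine ⟨D, e, U, _, hU, ⟨?_, ?_⟩, hsplit, hform⟩
  · exact (hRstate.1.submatrix _).smul (by positivity)
  · have htrace := congrArg trace hsplit
    rwa [hRstate.2, trace_kronecker, trace_ghzState i₀ hd, one_mul, eq_comm] at htrace

end Rigidity

/-! ### Optimality of the ideal realisation -/

section LowerPhase

variable {d : ℕ}

lemma lowerPhase_pow_apply (r : ℝ) (k : ℕ) (a b : Fin d) :
    (lowerPhase d r ^ k) a b =
      if (b : ℕ) = (a + k) % d then omegaPow d (((b : ℝ) - a) * r) else 0 := by
  induction k generalizing b with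
  | zero =>
    rw [pow_zero, add_zero, Nat.mod_eq_of_lt a.isLt, Matrix.one_apply]
    by_cases h : a = b
    · simp [h, omegaPow_zero]
    · rw [if_neg h, if_neg fun h' ↦ h (Fin.ext h'.symm)]
  | succ k ih =>
    rw [pow_succ, Matrix.mul_apply, Finset.sum_eq_single ⟨(a + k) % d, Nat.mod_lt _ a.pos⟩]
    · rw [ih, if_pos rfl, lowerPhase_apply, Nat.mod_add_mod, add_assoc]
      split_ifs
      · rw [← omegaPow_add]
        congr 1
        ring
      · simp
    · intro c _ hc
      rw [ih, if_neg fun h ↦ hc (Fin.ext h), zero_mul]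
    · simp

lemma lowerPhase_add_intCast (r : ℝ) (z : ℤ) :
    lowerPhase d (r + z) = omegaPow d z • lowerPhase d r := by
  ext a b
  rw [Matrix.smul_apply, lowerPhase_apply, lowerPhase_apply, smul_eq_mul]
  split_ifs with h
  · have hz : omegaPow d (((a + 1 - b : ℤ) * -z : ℤ) : ℝ) = 1 :=
      (omegaPow_intCast_eq_one_iff a.pos.ne' _).2 (((dvd_succ_sub_iff a b).2 h).mul_right _)
    rw [← one_mul (omegaPow d z * _), ← hz, ← omegaPow_add, ← omegaPow_add]
    congr 1
    push_cast
    ring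
  · rw [mul_zero]

lemma lowerPhase_pow_dim (d : ℕ) (r : ℝ) : lowerPhase d r ^ d = 1 := by
  ext a b
  rw [lowerPhase_pow_apply, Nat.add_mod_right, Nat.mod_eq_of_lt a.isLt, Matrix.one_apply]
  by_cases h : a = b
  · simp [h, omegaPow_zero]
  · rw [if_neg h, if_neg fun h' ↦ h (Fin.ext h'.symm)]

lemma lowerPhase_mul_conjTranspose (d : ℕ) (r : ℝ) : lowerPhase d r * (lowerPhase d r)ᴴ = 1 := by
  ext a b
  rw [Matrix.mul_apply, Finset.sum_eq_single ⟨(a + 1) % d, Nat.mod_lt _ a.pos⟩]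
  · rw [conjTranspose_apply, lowerPhase_apply, if_pos rfl, lowerPhase_apply, Matrix.one_apply]
    by_cases h : a = b
    · rw [h, if_pos rfl, if_pos rfl, star_omegaPow, omegaPow_mul_neg]
    · rw [if_neg h, if_neg, star_zero, mul_zero]
      intro hmod
      have hab : (a : ℕ) ≡ b [MOD d] := Nat.ModEq.add_right_cancel' 1 hmod
      exact h (Fin.ext (hab.eq_of_lt_of_lt a.isLt b.isLt))
  · intro c _ hc
    rw [lowerPhase_apply, if_neg fun h ↦ hc (Fin.ext h), zero_mul]
  · simp

lemma isObservable_lowerPhase (d : ℕ) (r : ℝ) : IsObservable d (lowerPhase d r) :=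
  ⟨mem_unitaryGroup_iff.2 (lowerPhase_mul_conjTranspose d r), lowerPhase_pow_dim d r⟩

end LowerPhase

section Oriented

variable {κ : Type*}

lemma oriented_oriented {R : Type*} [InvolutiveStar R] (i : ℕ) (X : R) :
    oriented i (oriented i X) = X := by
  unfold oriented
  split_ifs
  · rfl
  · rw [star_star]

lemma IsObservable.oriented [Fintype κ] [DecidableEq κ] {d : ℕ} {A : Matrix κ κ ℂ}
    (h : IsObservable d A) (i : ℕ) : IsObservable d (oriented i A) := by
  unfold ASTA.oriented
  split_ifs
  exacts [h, h.star]

lemma oriented_omegaPow_smul (d i : ℕ) (r : ℝ) (X : Matrix κ κ ℂ) :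
    oriented i (omegaPow d r • X) = omegaPow d ((-1) ^ i * r) • oriented i X := by
  unfold oriented
  split_ifs with hi
  · rw [hi.neg_one_pow, one_mul]
  · rw [(Nat.not_even_iff_odd.1 hi).neg_one_pow, neg_one_mul, star_smul, star_omegaPow]

lemma oriented_reindex_conj {ι : Type*} [Fintype κ] (i : ℕ) (e : κ ≃ ι) (U X : Matrix κ κ ℂ) :
    oriented i (reindex e e (U * X * Uᴴ)) = reindex e e (U * oriented i X * Uᴴ) := by
  unfold oriented
  split_ifs
  · rfl
  · simp only [star_eq_conjTranspose, conjTranspose_reindex, conjTranspose_mul,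
      conjTranspose_conjTranspose, Matrix.mul_assoc]

lemma oriented_kronecker_one {ι : Type*} [DecidableEq ι] (i : ℕ) (X : Matrix κ κ ℂ) :
    oriented i (X ⊗ₖ (1 : Matrix ι ι ℂ)) = oriented i X ⊗ₖ 1 := by
  unfold oriented
  split_ifs
  · rfl
  · simp only [star_eq_conjTranspose, conjTranspose_kronecker, conjTranspose_one]

end Oriented

section IdealObservables

variable {N m d : ℕ}

/-- The difference of `partyPhase` and the phases of the ideal observables. It vanishes in total,
so that it can be absorbed in local unitaries which fix the GHZ state. -/
noncomputable def idealOffset (m i : ℕ) : ℝ :=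
  if i = 0 then -(1 / m) else if i = 1 then 1 / m else 0

lemma sum_idealOffset (hN : 2 ≤ N) (m : ℕ) : ∑ i : Fin N, idealOffset m i = 0 := by
  obtain ⟨N, rfl⟩ := Nat.exists_eq_add_of_le' hN
  simp [Fin.sum_univ_succ, idealOffset]

lemma oriented_idealObs (hd : d ≠ 0) (m i x : ℕ) :
    oriented i (idealObs m d i x) = lowerPhase d (partyPhase m i x - idealOffset m i) := by
  rw [idealObs_eq hd, oriented, partyPhase, idealOffset]
  by_cases h0 : i = 0
  · simp only [h0, if_true, Even.zero]
    congr 1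
    ring
  by_cases h1 : i = 1
  · simp only [h1, if_true, one_ne_zero, if_false, Nat.not_even_one, star_eq_conjTranspose,
      conjTranspose_conjTranspose]
    congr 1
    ring
  simp only [h0, h1, if_false, sub_zero]
  split_ifs with hi
  · rw [hi.neg_one_pow, one_mul]
  · rw [(Nat.not_even_iff_odd.1 hi).neg_one_pow, neg_one_mul, star_eq_conjTranspose,
      conjTranspose_conjTranspose]

lemma isObservable_idealObs (hd : d ≠ 0) (m i x : ℕ) : IsObservable d (idealObs m d i x) := by
  rw [← oriented_oriented i (idealObs m d i x), oriented_idealObs hd]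
  exact (isObservable_lowerPhase d _).oriented i

lemma partyPhase_add_mul (hm : m ≠ 0) (i x z : ℕ) :
    partyPhase m i (x + m * z) = partyPhase m i x + (-1) ^ i * z := by
  unfold partyPhase
  split_ifs with hi
  · rw [hi]
    push_cast
    field_simp
    ring
  · push_cast
    field_simp

lemma oriented_extObs_idealObs (hd : d ≠ 0) (hm : m ≠ 0) (i q : ℕ) :
    oriented i (extObs d (fun x : Fin m ↦ idealObs m d i x) q) =
      lowerPhase d (partyPhase m i q - idealOffset m i) := by
  have hshift : lowerPhase d (partyPhase m i (q % m) - idealOffset m i + ((-1) ^ i * (q / m) : ℤ)) =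
      _ := lowerPhase_add_intCast _ _
  push_cast at hshift
  rw [extObs, dif_pos (Nat.pos_of_ne_zero hm), oriented_omegaPow_smul, oriented_idealObs hd]
  rw [show partyPhase m i q = partyPhase m i (q % m + m * (q / m)) by rw [Nat.mod_add_div],
    partyPhase_add_mul hm, add_sub_right_comm]
  exact hshift.symm

lemma firstFactor_idealObs (hd : d ≠ 0) (hm : 2 ≤ m) {k : ℕ} (hk : k < d) (q : ℕ) :
    firstFactor d (fun x : Fin m ↦ idealObs m d 0 x) k q =
      lowerPhase d (q / m - idealOffset m 0) ^ k := by
  have hext := oriented_extObs_idealObs hd (by omega : m ≠ 0) 0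
  simp only [oriented, Even.zero, if_true, partyPhase] at hext
  have hq : (((q + 1 : ℕ) : ℝ) / m - 1 / (2 * m) - idealOffset m 0) =
      q / m - idealOffset m 0 + 1 / (2 * m) := by
    push_cast
    field_simp
    ring
  rw [firstFactor, hext, hext, hq, sub_right_comm]
  ext a b
  simp only [Matrix.add_apply, Matrix.smul_apply, lowerPhase_pow_apply, smul_eq_mul]
  split_ifs with h
  · refine aCoeff_mul_omegaPow_add hd hm ?_ _
    rcases lt_or_ge ((a : ℕ) + k) d with hlt | hge
    · rw [h, Nat.mod_eq_of_lt hlt, Nat.cast_add, add_sub_cancel_left]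
      exact .inl rfl
    · rw [h, Nat.mod_eq_sub_mod hge, Nat.mod_eq_of_lt (by omega), Nat.cast_sub hge, Nat.cast_add]
      exact .inr (by ring)
  · simp

lemma bellFactor_idealObs (hd : d ≠ 0) (hm : 2 ≤ m) (α : Fin (N - 1) → Fin m) {k : ℕ}
    (hk : k < d) (i : Fin N) :
    bellFactor d (fun (i : Fin N) (x : Fin m) ↦ idealObs m d i x) α k i =
      lowerPhase d ((-1) ^ (i : ℕ) * ((if (i : ℕ) = 0 then (settingIndex α 0 : ℝ)
        else settingIndex α (i - 1) + settingIndex α i) / m) - idealOffset m i) ^ k := by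
  by_cases hi : (i : ℕ) = 0
  · simp only [bellFactor_zero hi, hi, firstFactor_idealObs hd hm hk, if_true, pow_zero, one_mul]
  · rw [bellFactor_eq_pow _ _ hi, bellFactor_one_eq, partyFactor, if_neg hi, if_neg hi,
      oriented_extObs_idealObs hd (by omega), partyPhase, if_neg hi, if_neg hi, Nat.cast_add]

lemma sum_neg_one_pow_mul_add (f : ℕ → ℝ) (n : ℕ) :
    ∑ i ∈ Finset.range (n + 1), (-1) ^ i * (if i = 0 then f 0 else f (i - 1) + f i) =
      (-1) ^ n * f n := by
  induction n with
  | zero => simp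
  | succ n ih =>
    rw [Finset.sum_range_succ, ih, if_neg n.succ_ne_zero, Nat.add_sub_cancel, pow_succ]
    ring

lemma sum_idealPhase (hN : 2 ≤ N) (α : Fin (N - 1) → Fin m) :
    ∑ i : Fin N, ((-1) ^ (i : ℕ) * ((if (i : ℕ) = 0 then (settingIndex α 0 : ℝ)
      else settingIndex α (i - 1) + settingIndex α i) / m) - idealOffset m i) = 0 := by
  have hlast : settingIndex α (N - 1) = 0 := dif_neg (lt_irrefl _)
  have hsum := sum_neg_one_pow_mul_add (fun j ↦ (settingIndex α j : ℝ)) (N - 1)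
  rw [hlast, Nat.cast_zero, mul_zero, Nat.sub_add_cancel (by omega)] at hsum
  simp only [Finset.sum_sub_distrib, sum_idealOffset hN, ← mul_div_assoc]
  rw [← Finset.sum_div, Fin.sum_univ_eq_sum_range (fun i ↦ (-1 : ℝ) ^ i *
    (if i = 0 then (settingIndex α 0 : ℝ) else settingIndex α (i - 1) + settingIndex α i)), hsum]
  simp

lemma tensor_lowerPhase_pow_mul_ghzState (i₀ : Fin N) (hd : d ≠ 0) {τ : Fin N → ℝ}
    (hτ : ∑ i, τ i = 0) (k : ℕ) :
    tensor (fun i ↦ lowerPhase d (τ i) ^ k) * ghzState N d = ghzState N d := by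
  have : NeZero d := ⟨hd⟩
  have hone : tensor (fun i ↦ lowerPhase d (τ i)) * ghzState N d = ghzState N d := by
    rw [ghzState, mul_vecMulVec, tensor_lowerPhase_mulVec_ghz i₀ hτ]
  suffices hpow : tensor (fun i ↦ lowerPhase d (τ i)) ^ k * ghzState N d = ghzState N d by
    rwa [tensor_pow] at hpow
  induction k with
  | zero => rw [pow_zero, Matrix.one_mul]
  | succ k ih => rw [pow_succ, Matrix.mul_assoc, hone, ih]

lemma bellValue_idealObs (hN : 2 ≤ N) (hd : 1 ≤ d) (hm : 2 ≤ m) :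
    bellValue d (fun (i : Fin N) (x : Fin m) ↦ idealObs m d i x) (ghzState N d) =
      (m : ℝ) ^ (N - 1) * (d - 1) := by
  have hd' : d ≠ 0 := by omega
  rw [bellValue_eq_sum, ← sum_Icc_const hd]
  refine Finset.sum_congr rfl fun k hk ↦ ?_
  have hkd : k < d := by rw [Finset.mem_Icc] at hk; omega
  have hterm : ∀ α : Fin (N - 1) → Fin m, (tensor (bellFactor d
      (fun (i : Fin N) (x : Fin m) ↦ idealObs m d i x) α k) * ghzState N d).trace.re = 1 := by
    intro α
    rw [funext (bellFactor_idealObs hd' hm α hkd),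
      tensor_lowerPhase_pow_mul_ghzState ⟨0, by omega⟩ hd' (sum_idealPhase hN α),
      trace_ghzState ⟨0, by omega⟩ hd', Complex.one_re]
  simp [hterm]

theorem isGreatest_quantumValues (hN : 2 ≤ N) (hd : 1 ≤ d) (hm : 2 ≤ m) :
    IsGreatest (quantumValues N m d) ((m : ℝ) ^ (N - 1) * (d - 1)) := by
  refine ⟨⟨fun _ ↦ d, fun i x ↦ idealObs m d i x, ghzState N d,
    isState_ghzState ⟨0, by omega⟩ (by omega), fun i x ↦ isObservable_idealObs (by omega) m i x,
    bellValue_idealObs hN hd hm⟩, ?_⟩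
  rintro v ⟨D, A, ρ, hρ, hA, rfl⟩
  exact bellValue_le hρ hN hd hm hA

end IdealObservables

section SelfTest

universe u

variable {N m d : ℕ} {n : Fin N → Type u} [∀ i, Fintype (n i)] [∀ i, DecidableEq (n i)]
  {A : ∀ i, Fin m → Matrix (n i) (n i) ℂ} {ρ : Matrix (∀ i, n i) (∀ i, n i) ℂ}

theorem IsOptimal.exists_unitary (h : IsOptimal d A ρ) (hN : 2 ≤ N) (hd : 2 ≤ d) (hm : 2 ≤ m)
    (hrank : ∀ i, (reducedState ρ i).rank = Fintype.card (n i)) :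
    ∃ (D : Fin N → ℕ) (e : ∀ i, n i ≃ Fin d × Fin (D i)) (U : ∀ i, Matrix (n i) (n i) ℂ)
      (σ : Matrix (∀ i, Fin (D i)) (∀ i, Fin (D i)) ℂ), (∀ i, U i ∈ unitaryGroup (n i) ℂ) ∧
      IsState σ ∧ reindex (splitEquiv e) (splitEquiv e) (tensor U * ρ * (tensor U)ᴴ) =
        ghzState N d ⊗ₖ σ ∧
      ∀ (i : Fin N) (x : Fin m), reindex (e i) (e i) (U i * A i x * (U i)ᴴ) =
        idealObs m d i x ⊗ₖ (1 : Matrix (Fin (D i)) (Fin (D i)) ℂ) := by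
  obtain ⟨S, P, hS, hSρ, hP, hA⟩ := h.exists_isShift hN hd hm hrank
  obtain ⟨D, e, U, σ, hU, hσ, hghz, hobs⟩ := exists_unitary_of_isShift ⟨0, by omega⟩ (by omega)
    h.isState hS hSρ hP (sum_idealOffset hN m)
  refine ⟨D, e, U, σ, hU, hσ, hghz, fun i x ↦ ?_⟩
  rw [← oriented_oriented i (reindex _ _ _), oriented_reindex_conj, hA, hobs,
    ← oriented_idealObs (by omega), ← oriented_kronecker_one, oriented_oriented]

end SelfTest

end ASTA

theorem theorem3p1 (N m d : ℕ) (hN : 2 ≤ N) (hm : 2 ≤ m) (hd : 2 ≤ d) :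
    -- `m ^ (N - 1) * (d - 1)` is the maximal quantum value of the Bell expression
    IsGreatest (ASTA.quantumValues N m d) ((m : ℝ) ^ (N - 1) * ((d : ℝ) - 1)) ∧
    -- and every realisation that reaches it is the ideal one up to local unitaries
    ∀ (n : Fin N → Type*) [∀ i, Fintype (n i)] [∀ i, DecidableEq (n i)]
      (A : ∀ i, Fin m → Matrix (n i) (n i) ℂ) (ρ : Matrix (∀ i, n i) (∀ i, n i) ℂ),
      ASTA.IsState ρ →
      (∀ i, (ASTA.reducedState ρ i).rank = Fintype.card (n i)) →
      (∀ i x, ASTA.IsObservable d (A i x)) →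
      ASTA.bellValue d A ρ = (m : ℝ) ^ (N - 1) * ((d : ℝ) - 1) →
      -- identifications of `ℂ^(n i)` with `ℂ^d ⊗ ℂ^(D i)`
      ∃ (D : Fin N → ℕ) (e : ∀ i, n i ≃ Fin d × Fin (D i))
        -- local unitaries
        (U : ∀ i, Matrix (n i) (n i) ℂ)
        -- the auxiliary state
        (σ : Matrix (∀ i, Fin (D i)) (∀ i, Fin (D i)) ℂ),
        (∀ i, U i ∈ Matrix.unitaryGroup (n i) ℂ) ∧
        ASTA.IsState σ ∧
        (∀ x y : ∀ i, n i,
          (ASTA.tensor U * ρ * (ASTA.tensor U).conjTranspose) x y =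
            ASTA.ghzState N d (fun i => (e i (x i)).1) (fun i => (e i (y i)).1) *
              σ (fun i => (e i (x i)).2) (fun i => (e i (y i)).2)) ∧
        (∀ (i : Fin N) (x : Fin m),
          Matrix.reindex (e i) (e i) (U i * A i x * (U i).conjTranspose) =
            ASTA.idealObs m d i x ⊗ₖ (1 : Matrix (Fin (D i)) (Fin (D i)) ℂ)) := by
  refine ⟨ASTA.isGreatest_quantumValues hN (by omega) hm, ?_⟩
  intro n _ _ A ρ hρ hrank hA hmax
  have hopt : ASTA.IsOptimal d A ρ := ⟨hρ, hA, hmax.ge⟩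
  obtain ⟨D, e, U, σ, hU, hσ, hghz, hobs⟩ := hopt.exists_unitary hN hd hm hrank
  refine ⟨D, e, U, σ, hU, hσ, fun x y ↦ ?_, hobs⟩
  have hxy := congrFun₂ hghz (ASTA.splitEquiv e x) (ASTA.splitEquiv e y)
  rwa [Matrix.reindex_apply, Matrix.submatrix_apply, Equiv.symm_apply_apply,
    Equiv.symm_apply_apply] at hxy
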